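/- Let $n\ge 5$ and $s$ be integers with $1<s<n/2$, and let $q=\lfloor n/s\rfloor$ and $r=n-qs$. For an integer $x$ let $\epsilon(x)=1$ if $x$ is odd and $\epsilon(x)=0$ if $x$ is even, and for real $a$ put $\kappa(a)=a+\frac{\epsilon(s)+\epsilon(q)}{2}$. Let $C_n(1,s)$ be the circulant graph with vertex set $\mathbb{Z}_n$ in which $i,j$ are adjacent if and only if $i-j\in\{1,-1,s,-s\}$. For a finite connected graph $G$, a routing $R$ of $G$ consists of one path $P_{x,y}$ in $G$, oriented from $x$ to $y$, for every ordered pair $(x,y)$ of distinct vertices. A colouring of the paths of $R$ is arc-conflict-free (respectively edge-conflict-free) if any two distinct paths in $R$ that traverse a common arc in the same direction (respectively that have a common edge, regardless of direction) receive distinct colours. Let $\overrightarrow{w}(G,R)$ (respectively $w(G,R)$) be the minimum number of colours in an arc-conflict-free (respectively edge-conflict-free) colouring of $R$. The directed and undirected optical indices of $G$ are $\overrightarrow{w}(G)=\min_R\overrightarrow{w}(G,R)$ and $w(G)=\min_R w(G,R)$, where the minima are over all routings $R$ of $G$. Then the following hold. (a) If $2\le s\le\sqrt{n-r+\kappa(-2)^2}+\kappa(-2)$,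 then $$\frac{n^2-\epsilon(n)}{8(s+1)}\le\overrightarrow{w}(C_n(1,s))\le\frac{s+2}{24}\Bigl(6q^2+3q(s+4)+s(4s+10)+\epsilon(q)(2q+3s+3)\Bigr).$$ (b) If $\sqrt{n-r+\kappa(-1)^2}+\kappa(-1)\le s\le\sqrt{n-r+\kappa(0)^2}+\kappa(0)$, then $$\frac{n^2-\epsilon(n)}{8(s+1)}\le\overrightarrow{w}(C_n(1,s))\le\frac{q(q+2)(5q+2)}{24}+\frac{s(s+2)(2s+5)}{6}+\epsilon(q)\,\frac{5q^2+13q+7}{8}.$$ (c) If $\sqrt{n-r+\kappa(1)^2}+\kappa(1)\le s<n/2$, then $$\max\left\{\frac{n^2-\epsilon(n)}{8(s+1)},\ \frac{(n-1)(\sqrt{2n}-7)^3}{24n}\right\}\le\overrightarrow{w}(C_n(1,s))\le\frac{q(q+2)(q+10)}{24}+\frac{s(s+2)(q+1)}{2}+\epsilon(q)\,\frac{(q+5)^2+4(s+1)^2}{8}.$$ Moreover, the same lower and upper bounds hold in (a), (b) and (c) with $\overrightarrow{w}(C_n(1,s))$ replaced by $w(C_n(1,s))/2$. -/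

import Mathlib

/-- The circulant graph `C_n(1,s)`: vertex set `ℤ/nℤ`, with `i`, `j` adjacent iff
`i - j ∈ {1, -1, s, -s}` (and `i ≠ j`, which is automatic when `1 < s < n/2`). -/
def circulantOneS (n s : ℕ) : SimpleGraph (ZMod n) :=
  SimpleGraph.circulantGraph {1, (s : ZMod n)}

section OpticalIndex

variable {V : Type*}

/-- A request of the all-to-all request set: an ordered pair of distinct nodes. -/
abbrev Request (V : Type*) : Type _ := {p : V × V // p.1 ≠ p.2}

/-- An all-to-all routing in `G`: for every ordered pair `(x, y)` of distinct nodes, a path of `G`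
oriented from `x` to `y`. -/
abbrev Routing (G : SimpleGraph V) : Type _ := (p : Request V) → G.Path p.1.1 p.1.2

/-- A colouring of the paths of `R` is arc-conflict-free if any two distinct paths that traverse a
common arc (in the same direction) receive distinct colours. -/
def IsArcConflictFree {G : SimpleGraph V} {κ : Type*} (R : Routing G) (c : Request V → κ) : Prop :=
  ∀ p p' : Request V, p ≠ p' →
    (∃ a : G.Dart, a ∈ (R p).1.darts ∧ a ∈ (R p').1.darts) → c p ≠ c p'

/-- A colouring of the paths of `R` is edge-conflict-free if any two distinct paths that have a
common edge (regardless of direction) receive distinct colours. -/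
def IsEdgeConflictFree {G : SimpleGraph V} {κ : Type*} (R : Routing G) (c : Request V → κ) : Prop :=
  ∀ p p' : Request V, p ≠ p' →
    (∃ e : Sym2 V, e ∈ (R p).1.edges ∧ e ∈ (R p').1.edges) → c p ≠ c p'

/-- The minimum number of colours in an arc-conflict-free colouring of `R`. -/
noncomputable def arcColourNumber {G : SimpleGraph V} (R : Routing G) : ℕ :=
  sInf {k : ℕ | ∃ c : Request V → Fin k, IsArcConflictFree R c}

/-- The minimum number of colours in an edge-conflict-free colouring of `R`. -/
noncomputable def edgeColourNumber {G : SimpleGraph V} (R : Routing G) : ℕ :=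
  sInf {k : ℕ | ∃ c : Request V → Fin k, IsEdgeConflictFree R c}

/-- The directed optical index of `G` (for a finite connected graph `G`, so that both minima are
over non-empty sets). -/
noncomputable def directedOpticalIndex (G : SimpleGraph V) : ℕ :=
  sInf {k : ℕ | ∃ R : Routing G, arcColourNumber R = k}

/-- The undirected optical index of `G` (for a finite connected graph `G`). -/
noncomputable def undirectedOpticalIndex (G : SimpleGraph V) : ℕ :=
  sInf {k : ℕ | ∃ R : Routing G, edgeColourNumber R = k}

end OpticalIndex

/-- `ε(x) = 1` if `x` is odd and `ε(x) = 0` if `x` is even. -/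
def parityEps (x : ℕ) : ℝ := ((x % 2 : ℕ) : ℝ)

/-- `κ(a) = a + (ε(s) + ε(q)) / 2`. -/
noncomputable def kappa (s q : ℕ) (a : ℝ) : ℝ := a + (parityEps s + parityEps q) / 2

/-! ### Symmetric routings, and edge load as a lower bound for both indices -/

section Optical

variable {V : Type*} {G : SimpleGraph V}

/-! Upper bounds. It suffices to route and colour one request from each opposite pair so that paths
sharing an edge get different colours. Opposite requests then follow the reversed paths, with the
same colours in the directed setting and a second palette in the undirected one
(`opticalIndex_le_of_half`). This is why the index and half the undirected index obey the same
bound.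

A displacement `δ ≤ n/2` is written `δ = b s + a`, with `b s` a nearest multiple of `s`, so `|a| ≤
s/2`; the path makes `b` long steps and then `|a|` unit steps. All paths of one displacement are
translates, and two of them share an edge only if their starting points differ by some `k` with `|k|
< |a|` or some `k s` with `|k| < b`. Greedy colouring needs at most `2|a| + 2b` colours. When `2|a|
≤ b + 1`, an explicit colouring modulo `b`, doubled to handle wraparound, uses only `2b`
(`exists_classColouring_two_mul`). Giving each displacement its own palette and summing over the
pairs `(b, |a|)` bounds both indices by a polynomial in `s/2` and `q/2`.

Lower bounds. In an optimal routing no edge carries more than `K` paths, where `K` is the undirected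
index or twice the directed one. Counting requests across the cut of an interval of `n/2` vertices
gives the bisection bound. The distance bound compares the total path length with `2nK`, using that
a ball of radius `k` has at most `(k+1)^2 + k^2` vertices.

Regimes. Since `n - r = q s`, each square-root condition is a linear comparison of `s` with `q`.
What remains is a polynomial inequality whose difference has nonnegative coefficients in suitable
nonnegative variables. -/

/-- The request in the opposite direction. -/
abbrev Request.swap (p : Request V) : Request V := ⟨p.1.swap, p.2.symm⟩

theorem Request.swap_swap (p : Request V) : p.swap.swap = p := rfl

open Classical in
/-- The routing that uses `Q` on the requests in `F` and reversed paths of `Q` on the others. -/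
noncomputable def symmetricRouting (Q : Routing G) (F : Request V → Prop) : Routing G :=
  fun p => if F p then Q p else (Q p.swap).reverse

open Classical in
/-- The representative of `p` or its swap lying in `F`. -/
noncomputable def forwardRequest (F : Request V → Prop) (p : Request V) : Request V :=
  if F p then p else p.swap

theorem directedOpticalIndex_le {k : ℕ} (R : Routing G) (c : Request V → Fin k)
    (hc : IsArcConflictFree R c) : directedOpticalIndex G ≤ k :=
  (Nat.sInf_le (s := {k : ℕ | ∃ R : Routing G, arcColourNumber R = k}) ⟨R, rfl⟩).trans
    (Nat.sInf_le (s := {k : ℕ | ∃ c : Request V → Fin k, IsArcConflictFree R c}) ⟨c, hc⟩)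

theorem undirectedOpticalIndex_le {k : ℕ} (R : Routing G) (c : Request V → Fin k)
    (hc : IsEdgeConflictFree R c) : undirectedOpticalIndex G ≤ k :=
  (Nat.sInf_le (s := {k : ℕ | ∃ R : Routing G, edgeColourNumber R = k}) ⟨R, rfl⟩).trans
    (Nat.sInf_le (s := {k : ℕ | ∃ c : Request V → Fin k, IsEdgeConflictFree R c}) ⟨c, hc⟩)

theorem symmetricRouting_of_pos (Q : Routing G) {F : Request V → Prop} {p : Request V} (h : F p) :
    symmetricRouting Q F p = Q p := if_pos h

theorem symmetricRouting_of_neg (Q : Routing G) {F : Request V → Prop} {p : Request V}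
    (h : ¬ F p) : symmetricRouting Q F p = (Q p.swap).reverse := if_neg h

theorem forwardRequest_of_pos {F : Request V → Prop} {p : Request V} (h : F p) :
    forwardRequest F p = p := if_pos h

theorem forwardRequest_of_neg {F : Request V → Prop} {p : Request V} (h : ¬ F p) :
    forwardRequest F p = p.swap := if_neg h

theorem mem_edges_symmetricRouting (Q : Routing G) (F : Request V → Prop) (p : Request V)
    (e : Sym2 V) :
    e ∈ (symmetricRouting Q F p).1.edges ↔ e ∈ (Q (forwardRequest F p)).1.edges := by
  by_cases h : F p
  · rw [symmetricRouting_of_pos Q h, forwardRequest_of_pos h]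
  · rw [symmetricRouting_of_neg Q h, forwardRequest_of_neg h, SimpleGraph.Path.reverse_coe,
      SimpleGraph.Walk.edges_reverse, List.mem_reverse]

theorem SimpleGraph.Walk.IsTrail.not_mem_darts_reverse {u v : V} {w : G.Walk u v}
    (hw : w.IsTrail) {d : G.Dart} (hd : d ∈ w.darts) : d ∉ w.reverse.darts := by
  rw [SimpleGraph.Walk.mem_darts_reverse]
  intro hd'
  have hn := hw.edges_nodup
  rw [SimpleGraph.Walk.edges_eq_map_darts] at hn
  have := List.inj_on_of_nodup_map hn hd hd' (by simp)
  exact d.symm_ne this.symm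

/-- A path and its reverse share no arc, so opposite requests may keep one colour in the directed
case. Any other two requests that share an arc have distinct representatives in `F` that share an
edge. In the undirected case the extra factor `Fin 2` separates the two orientations. -/
theorem opticalIndex_le_of_half {k : ℕ} (Q : Routing G) (F : Request V → Prop)
    (hF : ∀ p, F p.swap ↔ ¬ F p) (c : Request V → Fin k)
    (hc : ∀ p p', F p → F p' → p ≠ p' →
      (∃ e, e ∈ (Q p).1.edges ∧ e ∈ (Q p').1.edges) → c p ≠ c p') :
    directedOpticalIndex G ≤ k ∧ undirectedOpticalIndex G ≤ 2 * k := by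
  classical
  have hfwd : ∀ p, F (forwardRequest F p) := by
    intro p
    unfold forwardRequest
    split_ifs with h
    · exact h
    · exact (hF p).2 h
  have hinj : ∀ p p', (F p ↔ F p') → forwardRequest F p = forwardRequest F p' → p = p' := by
    intro p p' hpp h
    unfold forwardRequest at h
    by_cases hp : F p
    · simpa [hp, hpp.1 hp] using h
    · have hp' : ¬ F p' := fun h' => hp (hpp.2 h')
      simp only [hp, hp', if_false] at h
      exact congrArg Request.swap h
  constructor
  · refine directedOpticalIndex_le (symmetricRouting Q F) (fun p => c (forwardRequest F p)) ?_
    rintro p p' hne ⟨a, ha, ha'⟩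
    have he : ∃ e, e ∈ (Q (forwardRequest F p)).1.edges ∧
        e ∈ (Q (forwardRequest F p')).1.edges := by
      refine ⟨a.edge, ?_, ?_⟩ <;> rw [← mem_edges_symmetricRouting]
      · exact List.mem_map_of_mem ha
      · exact List.mem_map_of_mem ha'
    refine hc _ _ (hfwd p) (hfwd p') ?_ he
    intro heq
    by_cases hpp : F p ↔ F p'
    · exact hne (hinj p p' hpp heq)
    · have hsw : p' = p.swap := by
        unfold forwardRequest at heq
        by_cases hp : F p
        · have hp' : ¬ F p' := fun h' => hpp ⟨fun _ => h', fun _ => hp⟩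
          simp only [hp, hp', if_true, if_false] at heq
          rw [heq, Request.swap_swap]
        · have hp' : F p' := by by_contra h'; exact hpp ⟨fun h => (hp h).elim, fun h => (h' h).elim⟩
          simp only [hp, hp', if_true, if_false] at heq
          exact heq.symm
      subst hsw
      unfold symmetricRouting at ha ha'
      by_cases hp : F p
      · have hp' : ¬ F p.swap := fun h => (hF p).1 h hp
        simp only [hp, hp'] at ha ha'
        exact (Q p).2.isTrail.not_mem_darts_reverse ha ha'
      · have hp' : F p.swap := (hF p).2 hp
        simp only [hp, hp'] at ha ha'
        exact (Q p.swap).2.isTrail.not_mem_darts_reverse ha' ha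
  · let c' : Request V → Fin 2 × Fin k :=
      fun p => (if F p then 0 else 1, c (forwardRequest F p))
    refine undirectedOpticalIndex_le (symmetricRouting Q F)
      (fun p => finProdFinEquiv (c' p)) ?_
    rintro p p' hne ⟨e, he, he'⟩ heq
    rw [mem_edges_symmetricRouting] at he he'
    have heq := finProdFinEquiv.injective heq
    have h1 : (if F p then (0 : Fin 2) else 1) = if F p' then 0 else 1 := congrArg Prod.fst heq
    have h2 : c (forwardRequest F p) = c (forwardRequest F p') := congrArg Prod.snd heq
    have hpp : F p ↔ F p' := by
      by_cases hp : F p <;> by_cases hp' : F p' <;> simp_all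
    exact hc _ _ (hfwd p) (hfwd p') (fun h => hne (hinj p p' hpp h)) ⟨e, he, he'⟩ h2

/-- The number of requests routed by `R` through the edge `e`. -/
noncomputable def edgeLoad [Fintype V] [DecidableEq V] (R : Routing G) (e : Sym2 V) : ℕ :=
  (Finset.univ.filter fun p : Request V => e ∈ (R p).1.edges).card

theorem exists_isArcConflictFree [Fintype V] [DecidableEq V] (h : Nonempty (Routing G)) :
    ∃ (R : Routing G) (c : Request V → Fin (directedOpticalIndex G)), IsArcConflictFree R c := by
  obtain ⟨R₀⟩ := h
  obtain ⟨R, hR⟩ := Nat.sInf_mem (s := {k : ℕ | ∃ R : Routing G, arcColourNumber R = k})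
    ⟨_, R₀, rfl⟩
  have hne : {k : ℕ | ∃ c : Request V → Fin k, IsArcConflictFree R c}.Nonempty :=
    ⟨Fintype.card (Request V), Fintype.equivFin _, fun p p' h _ h' =>
      h ((Fintype.equivFin _).injective h')⟩
  have := Nat.sInf_mem hne
  change ∃ c : Request V → Fin (arcColourNumber R), IsArcConflictFree R c at this
  rw [hR] at this
  exact ⟨R, this⟩

theorem exists_isEdgeConflictFree [Fintype V] [DecidableEq V] (h : Nonempty (Routing G)) :
    ∃ (R : Routing G) (c : Request V → Fin (undirectedOpticalIndex G)),
      IsEdgeConflictFree R c := by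
  obtain ⟨R₀⟩ := h
  obtain ⟨R, hR⟩ := Nat.sInf_mem (s := {k : ℕ | ∃ R : Routing G, edgeColourNumber R = k})
    ⟨_, R₀, rfl⟩
  have hne : {k : ℕ | ∃ c : Request V → Fin k, IsEdgeConflictFree R c}.Nonempty :=
    ⟨Fintype.card (Request V), Fintype.equivFin _, fun p p' h _ h' =>
      h ((Fintype.equivFin _).injective h')⟩
  have := Nat.sInf_mem hne
  change ∃ c : Request V → Fin (edgeColourNumber R), IsEdgeConflictFree R c at this
  rw [hR] at this
  exact ⟨R, this⟩

/-- The requests through a given edge receive pairwise distinct colours. -/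
theorem exists_edgeLoad_le_undirectedOpticalIndex [Fintype V] [DecidableEq V] (h : Nonempty (Routing G)) :
    ∃ R : Routing G, ∀ e, edgeLoad R e ≤ undirectedOpticalIndex G := by
  obtain ⟨R, c, hc⟩ := exists_isEdgeConflictFree h
  refine ⟨R, fun e => ?_⟩
  have := Finset.card_le_card_of_injOn (t := Finset.univ)
    (s := Finset.univ.filter fun p : Request V => e ∈ (R p).1.edges) c (by simp) ?_
  · simpa [edgeLoad] using this
  · intro p hp p' hp' heq
    by_contra hne
    exact hc p p' hne ⟨e, by simpa using hp, by simpa using hp'⟩ heq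

/-- Each edge carries two arcs, and the requests through a given arc receive pairwise distinct
colours. -/
theorem exists_edgeLoad_le_two_mul_directedOpticalIndex [Fintype V] [DecidableEq V] (h : Nonempty (Routing G)) :
    ∃ R : Routing G, ∀ e, edgeLoad R e ≤ 2 * directedOpticalIndex G := by
  obtain ⟨R, c, hc⟩ := exists_isArcConflictFree h
  refine ⟨R, fun e => ?_⟩
  by_cases he : e ∈ G.edgeSet
  swap
  · have : edgeLoad R e = 0 := by
      unfold edgeLoad
      rw [Finset.card_eq_zero, Finset.filter_eq_empty_iff]
      intro p _ hp
      exact he (SimpleGraph.Walk.edges_subset_edgeSet _ hp)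
    omega
  have key : ∀ d : G.Dart,
      (Finset.univ.filter fun p : Request V => d ∈ (R p).1.darts).card
        ≤ directedOpticalIndex G := by
    intro d
    have := Finset.card_le_card_of_injOn (t := Finset.univ)
      (s := Finset.univ.filter fun p : Request V => d ∈ (R p).1.darts) c (by simp) ?_
    · simpa using this
    · intro p hp p' hp' heq
      by_contra hne
      exact hc p p' hne ⟨d, by simpa using hp, by simpa using hp'⟩ heq
  induction e using Sym2.ind with
  | _ u v =>
    have huv : G.Adj u v := he
    let d : G.Dart := ⟨(u, v), huv⟩
    have hsub : (Finset.univ.filter fun p : Request V => s(u, v) ∈ (R p).1.edges) ⊆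
        (Finset.univ.filter fun p : Request V => d ∈ (R p).1.darts) ∪
        (Finset.univ.filter fun p : Request V => d.symm ∈ (R p).1.darts) := by
      intro p hp
      simp only [Finset.mem_filter, Finset.mem_univ, true_and, Finset.mem_union] at hp ⊢
      rw [SimpleGraph.Walk.edges_eq_map_darts, List.mem_map] at hp
      obtain ⟨d', hd', hde⟩ := hp
      have : d'.edge = d.edge := hde
      rcases SimpleGraph.dart_edge_eq_iff _ _ |>.1 this with h | h
      · left; rwa [← h]
      · right; rwa [← h]
    have h1 := Finset.card_le_card hsub
    have h2 := Finset.card_union_le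
      (Finset.univ.filter fun p : Request V => d ∈ (R p).1.darts)
      (Finset.univ.filter fun p : Request V => d.symm ∈ (R p).1.darts)
    have h3 := key d
    have h4 := key d.symm
    unfold edgeLoad
    omega

/-- Double counting: requests that each use an edge of `E` number at most `#E` times the load. -/
theorem card_le_card_mul_of_edgeLoad_le [Fintype V] [DecidableEq V] {R : Routing G} {K : ℕ}
    (hR : ∀ e, edgeLoad R e ≤ K) (E : Finset (Sym2 V)) (P : Finset (Request V))
    (hP : ∀ p ∈ P, ∃ e ∈ E, e ∈ (R p).1.edges) : P.card ≤ E.card * K := by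
  have hsub : P ⊆ E.biUnion fun e => Finset.univ.filter fun p : Request V => e ∈ (R p).1.edges := by
    intro p hp
    obtain ⟨e, he, hpe⟩ := hP p hp
    simp only [Finset.mem_biUnion, Finset.mem_filter, Finset.mem_univ, true_and]
    exact ⟨e, he, hpe⟩
  refine (Finset.card_le_card hsub).trans (Finset.card_biUnion_le_card_mul _ _ _ ?_)
  intro e _
  exact hR e

theorem sum_length_le_of_edgeLoad_le [Fintype V] [DecidableEq V] {R : Routing G} {K : ℕ}
    (hR : ∀ e, edgeLoad R e ≤ K) (E : Finset (Sym2 V)) (hE : ∀ e ∈ G.edgeSet, e ∈ E) :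
    ∑ p : Request V, (R p).1.length ≤ E.card * K := by
  have h1 : ∀ p : Request V, (R p).1.length
      = (E.filter fun e => e ∈ (R p).1.edges).card := by
    intro p
    have : (E.filter fun e => e ∈ (R p).1.edges) = (R p).1.edges.toFinset := by
      ext e
      simp only [Finset.mem_filter, List.mem_toFinset, and_iff_right_iff_imp]
      exact fun h => hE e (SimpleGraph.Walk.edges_subset_edgeSet _ h)
    rw [this, List.toFinset_card_of_nodup (R p).2.isTrail.edges_nodup,
      SimpleGraph.Walk.length_edges]
  simp only [h1, Finset.card_filter]
  rw [Finset.sum_comm]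
  refine (Finset.sum_le_card_nsmul E _ K ?_).trans (by simp)
  intro e _
  rw [← Finset.card_filter]
  exact hR e

end Optical

/-! ### Lower bounds from interval cuts and from distances -/

section CirculantLowerBounds

variable {n s : ℕ}

theorem circulantOneS_adj_cases {u v : ZMod n} (h : (circulantOneS n s).Adj u v) :
    ((v = u + (1 : ℕ) ∨ u = v + (1 : ℕ)) ∨ (v = u + (s : ℕ) ∨ u = v + (s : ℕ))) := by
  simp only [circulantOneS, SimpleGraph.circulantGraph_adj, Set.mem_insert_iff,
    Set.mem_singleton_iff] at h
  push_cast
  grind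

theorem ZMod.val_add_natCast [NeZero n] (u : ZMod n) {c : ℕ} (hc : c ≤ n) :
    (u.val + c < n ∧ (u + (c : ZMod n)).val = u.val + c) ∨
      (n ≤ u.val + c ∧ (u + (c : ZMod n)).val + n = u.val + c) := by
  have h : (u + (c : ZMod n)).val = (u.val + c) % n := by
    rw [ZMod.val_add, ZMod.val_natCast, Nat.add_mod_mod]
  have hu := ZMod.val_lt u
  rcases lt_or_ge (u.val + c) n with h' | h'
  · left; exact ⟨h', by rw [h, Nat.mod_eq_of_lt h']⟩
  · right
    refine ⟨h', ?_⟩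
    rcases eq_or_lt_of_le hc with hcn | hcn
    · rw [h, hcn, Nat.add_mod_right, Nat.mod_eq_of_lt hu]
    · rw [h, Nat.mod_eq_sub_mod h', Nat.mod_eq_of_lt (by omega)]; omega

/-- The edges `{x, x + c}` with exactly one end in `{0, …, m - 1}`. -/
def cutEdges (n m c : ℕ) : Finset (Sym2 (ZMod n)) :=
  (Finset.Ico (m - c) m ∪ Finset.Ico (n - c) n).image
    fun x : ℕ => s((x : ZMod n), (x : ZMod n) + (c : ZMod n))

theorem card_cutEdges_le (n m c : ℕ) : (cutEdges n m c).card ≤ 2 * c := by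
  refine Finset.card_image_le.trans ((Finset.card_union_le _ _).trans ?_)
  simp only [Nat.card_Ico]
  omega

theorem mem_cutEdges [NeZero n] {m c : ℕ} (hc : c ≤ n) {u v : ZMod n}
    (huv : v = u + (c : ZMod n)) (h : u.val < m ↔ ¬ v.val < m) : s(u, v) ∈ cutEdges n m c := by
  refine Finset.mem_image.2 ⟨u.val, ?_, ?_⟩
  · have hu := ZMod.val_lt u
    rcases ZMod.val_add_natCast u hc with ⟨h1, h2⟩ | ⟨h1, h2⟩ <;> rw [← huv] at h2 <;>
      simp only [Finset.mem_union, Finset.mem_Ico] <;> omega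
  · simp [huv]

/-- The cut around an interval has at most `2` unit edges and `2s` long ones, and every request
between the interval and its complement crosses it. -/
theorem two_mul_mul_sub_le_of_edgeLoad_le [NeZero n] (hs : s ≤ n) {R : Routing (circulantOneS n s)}
    {K : ℕ} (hR : ∀ e, edgeLoad R e ≤ K) (m : ℕ) :
    2 * (m * (n - m)) ≤ 2 * (s + 1) * K := by
  have hn : 1 ≤ n := NeZero.one_le
  let P : Finset (Request (ZMod n)) :=
    Finset.univ.filter fun p => (p.1.1.val < m ↔ ¬ p.1.2.val < m)
  have h1 : P.card ≤ (cutEdges n m 1 ∪ cutEdges n m s).card * K := by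
    refine card_le_card_mul_of_edgeLoad_le hR _ _ ?_
    intro p hp
    have hp : p.1.1.val < m ↔ ¬ p.1.2.val < m := by simpa [P] using hp
    have hd : ∃ d ∈ (R p).1.darts, (d.fst.val < m ↔ ¬ d.snd.val < m) := by
      by_cases h : p.1.1.val < m
      · obtain ⟨d, hd, h1, h2⟩ := (R p).1.exists_boundary_dart {v | v.val < m} h (hp.1 h)
        exact ⟨d, hd, iff_of_true h1 h2⟩
      · obtain ⟨d, hd, h1, h2⟩ := (R p).1.exists_boundary_dart {v | ¬ v.val < m} h
          (fun h' => h' (by_contra fun h'' => h (hp.2 h'')))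
        exact ⟨d, hd, iff_of_false h1 h2⟩
    obtain ⟨d, hd, hcut⟩ := hd
    refine ⟨s(d.fst, d.snd), ?_, List.mem_map_of_mem hd⟩
    have hcut' : d.snd.val < m ↔ ¬ d.fst.val < m := by tauto
    rcases circulantOneS_adj_cases d.adj with (h | h) | (h | h)
    · exact Finset.mem_union_left _ (mem_cutEdges hn h hcut)
    · rw [Sym2.eq_swap]; exact Finset.mem_union_left _ (mem_cutEdges hn h hcut')
    · exact Finset.mem_union_right _ (mem_cutEdges hs h hcut)
    · rw [Sym2.eq_swap]; exact Finset.mem_union_right _ (mem_cutEdges hs h hcut')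
  have h2 : (cutEdges n m 1 ∪ cutEdges n m s).card ≤ 2 * (s + 1) := by
    have := Finset.card_union_le (cutEdges n m 1) (cutEdges n m s)
    have := card_cutEdges_le n m 1
    have := card_cutEdges_le n m s
    omega
  have h3 : 2 * (m * (n - m)) ≤ P.card := by
    have hsub : (Finset.range m ×ˢ Finset.Ico m n) ∪ (Finset.Ico m n ×ˢ Finset.range m) ⊆
        P.image fun p => (p.1.1.val, p.1.2.val) := by
      rintro ⟨i, j⟩ hij
      simp only [Finset.mem_union, Finset.mem_product, Finset.mem_range, Finset.mem_Ico] at hij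
      have hi : ((i : ZMod n)).val = i := ZMod.val_cast_of_lt (by omega)
      have hj : ((j : ZMod n)).val = j := ZMod.val_cast_of_lt (by omega)
      have hne : (i : ZMod n) ≠ j := by
        intro h
        rw [h, hj] at hi
        omega
      refine Finset.mem_image.2 ⟨⟨((i : ZMod n), (j : ZMod n)), hne⟩, ?_, by simp [hi, hj]⟩
      simp only [P, Finset.mem_filter, Finset.mem_univ, true_and, hi, hj]
      omega
    have hdisj : Disjoint (Finset.range m ×ˢ Finset.Ico m n)
        (Finset.Ico m n ×ˢ Finset.range m) := by
      rw [Finset.disjoint_left]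
      rintro ⟨i, j⟩ h1 h2
      simp only [Finset.mem_product, Finset.mem_range, Finset.mem_Ico] at h1 h2
      omega
    have := (Finset.card_le_card hsub).trans Finset.card_image_le
    rw [Finset.card_union_of_disjoint hdisj] at this
    simp only [Finset.card_product, Finset.card_range, Nat.card_Ico] at this
    rw [mul_comm (n - m)] at this
    omega
  exact h3.trans (h1.trans (Nat.mul_le_mul_right K h2))

/-- The vertices reached from `x` by `ℓ` steps. -/
theorem exists_eq_of_walk {x y : ZMod n} (w : (circulantOneS n s).Walk x y) :
    ∃ i j : ℕ, i ≤ w.length ∧ j ≤ w.length ∧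
      y = x + ((i : ZMod n) + j - w.length) + ((i : ZMod n) - j) * s := by
  induction w with
  | nil => exact ⟨0, 0, by simp⟩
  | cons h p ih =>
    obtain ⟨i, j, hi, hj, hw⟩ := ih
    simp only [SimpleGraph.Walk.length_cons]
    generalize p.length = l at hi hj hw ⊢
    rw [hw]
    -- In coordinates rotated by 45 degrees, the steps `+1`, `-1`, `+s`, `-s` raise both of `i, j`,
    -- neither, `i` only, `j` only. Hence `l` steps reach at most `(l + 1)^2` points.
    rcases circulantOneS_adj_cases h with (h | h) | (h | h)
    · refine ⟨i + 1, j + 1, by omega, by omega, ?_⟩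
      rw [h]; push_cast; ring
    · refine ⟨i, j, by omega, by omega, ?_⟩
      rw [h]; push_cast; ring
    · refine ⟨i + 1, j, by omega, by omega, ?_⟩
      rw [h]; push_cast; ring
    · refine ⟨i, j + 1, by omega, by omega, ?_⟩
      rw [h]; push_cast; ring

/-- A set containing all vertices within distance `k` of `x`. -/
def latticeBall (n s k : ℕ) (x : ZMod n) : Finset (ZMod n) :=
  ((Finset.range (k + 1) ×ˢ Finset.range (k + 1)).image fun p : ℕ × ℕ =>
    x + ((p.1 : ZMod n) + p.2 - k) + ((p.1 : ZMod n) - p.2) * s) ∪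
  ((Finset.range k ×ˢ Finset.range k).image fun p : ℕ × ℕ =>
    x + ((p.1 : ZMod n) + p.2 + 1 - k) + ((p.1 : ZMod n) - p.2) * s)

theorem card_latticeBall_le (n s k : ℕ) (x : ZMod n) :
    (latticeBall n s k x).card ≤ (k + 1) ^ 2 + k ^ 2 := by
  refine (Finset.card_union_le _ _).trans (add_le_add ?_ ?_) <;>
  · refine Finset.card_image_le.trans (le_of_eq ?_)
    simp [sq]

theorem mem_latticeBall {x y : ZMod n} (w : (circulantOneS n s).Walk x y) {k : ℕ}
    (hk : w.length ≤ k) : y ∈ latticeBall n s k x := by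
  obtain ⟨i, j, hi, hj, hy⟩ := exists_eq_of_walk w
  obtain ⟨d, hd⟩ := Nat.exists_eq_add_of_le hk
  -- Raising both indices by `t` absorbs `2t` units of slack, so the parity of the slack selects the
  -- grid for `k` or the one for `k - 1`.
  obtain ⟨t, ht⟩ := Nat.even_or_odd' d
  rw [latticeBall, Finset.mem_union, Finset.mem_image, Finset.mem_image]
  rcases ht with ht | ht
  · left
    refine ⟨(i + t, j + t), ?_, ?_⟩
    · simp only [Finset.mem_product, Finset.mem_range]; omega
    · rw [hy, hd, ht]; push_cast; ring
  · right
    refine ⟨(i + t, j + t), ?_, ?_⟩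
    · simp only [Finset.mem_product, Finset.mem_range]; omega
    · rw [hy, hd, ht]; push_cast; ring

theorem sq_le_card_length_lt_add [NeZero n] (R : Routing (circulantOneS n s)) (k : ℕ) :
    n * n ≤ (Finset.univ.filter fun p : Request (ZMod n) => k < (R p).1.length).card
      + n * ((k + 1) ^ 2 + k ^ 2) := by
  set A := Finset.univ.filter fun p : Request (ZMod n) => k < (R p).1.length
  let B : Finset (ZMod n × ZMod n) :=
    Finset.univ.biUnion fun x => (latticeBall n s k x).image fun y => (x, y)
  have hsub : (Finset.univ : Finset (ZMod n × ZMod n)) ⊆ A.image Subtype.val ∪ B := by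
    rintro ⟨x, y⟩ -
    have hB : ∀ w : (circulantOneS n s).Walk x y, w.length ≤ k → (x, y) ∈ B := fun w hw =>
      Finset.mem_biUnion.2 ⟨x, Finset.mem_univ _, Finset.mem_image.2 ⟨y, mem_latticeBall w hw, rfl⟩⟩
    rw [Finset.mem_union]
    by_cases hxy : x = y
    · subst hxy
      exact Or.inr (hB .nil (by simp))
    · let p : Request (ZMod n) := ⟨(x, y), hxy⟩
      by_cases hp : k < (R p).1.length
      · exact Or.inl (Finset.mem_image.2 ⟨p, by simpa [A] using hp, rfl⟩)
      · exact Or.inr (hB (R p).1 (not_lt.1 hp))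
  have h1 := Finset.card_le_card hsub
  rw [Finset.card_univ, Fintype.card_prod, ZMod.card] at h1
  have h2 := Finset.card_union_le (A.image Subtype.val) B
  have h3 : (A.image Subtype.val).card ≤ A.card := Finset.card_image_le
  have h4 : B.card ≤ n * ((k + 1) ^ 2 + k ^ 2) := by
    have := Finset.card_biUnion_le_card_mul (Finset.univ : Finset (ZMod n))
      (fun x => (latticeBall n s k x).image fun y => (x, y)) ((k + 1) ^ 2 + k ^ 2)
      (fun x _ => Finset.card_image_le.trans (card_latticeBall_le n s k x))
    simpa using this
  omega

/-- The total path length is at least the sum over `k < t` of the number of paths longer than `k`,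
and at most `2nK` because the graph has at most `2n` edges. -/
theorem mul_le_of_edgeLoad_le [NeZero n] {R : Routing (circulantOneS n s)} {K : ℕ}
    (hR : ∀ e, edgeLoad R e ≤ K) (t : ℕ) :
    t * n ≤ 2 * K + ∑ k ∈ Finset.range t, ((k + 1) ^ 2 + k ^ 2) := by
  let E : Finset (Sym2 (ZMod n)) :=
    (Finset.univ.image fun x : ZMod n => s(x, x + (1 : ℕ))) ∪
      (Finset.univ.image fun x : ZMod n => s(x, x + (s : ℕ)))
  have hE : ∀ e ∈ (circulantOneS n s).edgeSet, e ∈ E := by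
    intro e he
    induction e using Sym2.ind with
    | _ u v =>
      have huv : (circulantOneS n s).Adj u v := he
      simp only [E, Finset.mem_union, Finset.mem_image, Finset.mem_univ, true_and]
      rcases circulantOneS_adj_cases huv with (h | h) | (h | h)
      · exact Or.inl ⟨u, by rw [h]⟩
      · exact Or.inl ⟨v, by rw [h, Sym2.eq_swap]⟩
      · exact Or.inr ⟨u, by rw [h]⟩
      · exact Or.inr ⟨v, by rw [h, Sym2.eq_swap]⟩
  have hEc : E.card ≤ 2 * n := by
    have h1 : E.card ≤ _ + _ := Finset.card_union_le
      (Finset.univ.image fun x : ZMod n => s(x, x + (1 : ℕ)))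
      (Finset.univ.image fun x : ZMod n => s(x, x + (s : ℕ)))
    have h2 : (Finset.univ.image fun x : ZMod n => s(x, x + (1 : ℕ))).card ≤ n :=
      Finset.card_image_le.trans (by simp)
    have h3 : (Finset.univ.image fun x : ZMod n => s(x, x + (s : ℕ))).card ≤ n :=
      Finset.card_image_le.trans (by simp)
    omega
  have h1 := (sum_length_le_of_edgeLoad_le hR E hE).trans (Nat.mul_le_mul_right K hEc)
  have h2 : ∑ k ∈ Finset.range t,
      (Finset.univ.filter fun p : Request (ZMod n) => k < (R p).1.length).card
        ≤ ∑ p : Request (ZMod n), (R p).1.length := by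
    simp only [Finset.card_filter]
    rw [Finset.sum_comm]
    refine Finset.sum_le_sum fun p _ => ?_
    rw [← Finset.card_filter]
    calc _ ≤ (Finset.range (R p).1.length).card := by
          refine Finset.card_le_card fun k hk => ?_
          simp only [Finset.mem_filter, Finset.mem_range] at hk ⊢
          exact hk.2
      _ = _ := Finset.card_range _
  have h3 := Finset.sum_le_sum fun k (_ : k ∈ Finset.range t) => sq_le_card_length_lt_add R k
  rw [Finset.sum_add_distrib, Finset.sum_const, Finset.card_range, smul_eq_mul,
    ← Finset.mul_sum] at h3
  have hn : 0 < n := NeZero.pos n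
  refine Nat.le_of_mul_le_mul_left (?_ : n * _ ≤ n * _) hn
  calc n * (t * n) = t * (n * n) := by ring
    _ ≤ _ := h3
    _ ≤ 2 * n * K + n * ∑ k ∈ Finset.range t, ((k + 1) ^ 2 + k ^ 2) := by
      exact Nat.add_le_add_right (h2.trans h1) _
    _ = _ := by ring

theorem three_mul_sum_sq_add_sq (t : ℕ) :
    3 * ∑ k ∈ Finset.range t, ((k + 1) ^ 2 + k ^ 2) = t * (2 * t ^ 2 + 1) := by
  induction t with
  | zero => simp
  | succ t ih => rw [Finset.sum_range_succ, mul_add, ih]; ring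

theorem bisection_bound_of_edgeLoad_le [NeZero n] (hs : s ≤ n)
    {R : Routing (circulantOneS n s)} {K : ℕ} (hR : ∀ e, edgeLoad R e ≤ K) :
    ((n : ℝ) ^ 2 - parityEps n) / (8 * ((s : ℝ) + 1)) ≤ (K : ℝ) / 2 := by
  have h := two_mul_mul_sub_le_of_edgeLoad_le hs hR (n / 2)
  have h4 : (n : ℝ) ^ 2 - parityEps n = 4 * ((n / 2 * (n - n / 2) : ℕ) : ℝ) := by
    rcases Nat.even_or_odd' n with ⟨c, hc | hc⟩
    · have h1 : n / 2 = c := by omega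
      have h2 : n - n / 2 = c := by omega
      have h3 : n % 2 = 0 := by omega
      rw [h2, h1, parityEps, h3, hc]; push_cast; ring
    · have h1 : n / 2 = c := by omega
      have h2 : n - n / 2 = c + 1 := by omega
      have h3 : n % 2 = 1 := by omega
      rw [h2, h1, parityEps, h3, hc]; push_cast; ring
  rw [h4, div_le_iff₀ (by positivity)]
  have : ((2 * (n / 2 * (n - n / 2)) : ℕ) : ℝ) ≤ ((2 * (s + 1) * K : ℕ) : ℝ) := by exact_mod_cast h
  push_cast at this ⊢
  linarith

theorem distance_bound_of_edgeLoad_le [NeZero n]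
    {R : Routing (circulantOneS n s)} {K : ℕ} (hR : ∀ e, edgeLoad R e ≤ K) :
    ((n : ℝ) - 1) * (√(2 * (n : ℝ)) - 7) ^ 3 / (24 * (n : ℝ)) ≤ (K : ℝ) / 2 := by
  have hn : (1 : ℝ) ≤ n := by exact_mod_cast NeZero.one_le
  have hK : (0 : ℝ) ≤ K := Nat.cast_nonneg K
  set t := √(2 * (n : ℝ)) with ht
  have ht2 : t ^ 2 = 2 * n := Real.sq_sqrt (by positivity)
  rw [div_le_iff₀ (by positivity)]
  -- Below `7` the cube is nonpositive and the bound is trivial.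
  rcases le_total t 7 with h7 | h7
  · have : (t - 7) ^ 3 ≤ 0 := Odd.pow_nonpos (by decide) (by linarith)
    have h1 : ((n : ℝ) - 1) * (t - 7) ^ 3 ≤ 0 := mul_nonpos_of_nonneg_of_nonpos (by linarith) this
    have h2 : 0 ≤ (K : ℝ) / 2 * (24 * n) := by positivity
    linarith
  -- The leading part `3mn - 2m^3` of the lower bound for `6K` is maximal at `m = √(n/2) = t/2`;
  -- rounding down costs lower-order terms, absorbed by the `7`.
  · have h := mul_le_of_edgeLoad_le hR ⌊t / 2⌋₊
    have h3 := three_mul_sum_sq_add_sq ⌊t / 2⌋₊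
    have hlo := Nat.floor_le (show 0 ≤ t / 2 by linarith)
    have hhi := Nat.lt_floor_add_one (t / 2)
    set m := ⌊t / 2⌋₊
    have h4 : 3 * (m * n) ≤ 6 * K + m * (2 * m ^ 2 + 1) := by omega
    have h5 : 3 * ((m : ℝ) * n) ≤ 6 * K + m * (2 * (m : ℝ) ^ 2 + 1) := by exact_mod_cast h4
    obtain ⟨u, hu⟩ : ∃ u : ℝ, (m : ℝ) = t / 2 - u := ⟨t / 2 - m, by ring⟩
    rw [hu] at h5 hlo hhi
    have hu0 : 0 ≤ u := by linarith
    have hu1 : u ≤ 1 := by linarith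
    have hn' : (n : ℝ) = t ^ 2 / 2 := by linarith
    have h6 : (t - 7) ^ 3 / 6 ≤ 2 * K := by
      rw [hn'] at h5
      have e1 : (t / 2 - u) * (t ^ 2 / 2) - (t / 2 - u) * (2 * (t / 2 - u) ^ 2 + 1) / 3
          = t ^ 3 / 6 - t * u ^ 2 + 2 * u ^ 3 / 3 - t / 6 + u / 3 := by ring
      have e2 : t * u ^ 2 ≤ t :=
        mul_le_of_le_one_right (by linarith) (pow_le_one₀ hu0 hu1)
      have e3 : 0 ≤ u ^ 3 := by positivity
      nlinarith [sq_nonneg (t - 4)]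
    have h8 : 0 ≤ (t - 7) ^ 3 := by
      have : 0 ≤ t - 7 := by linarith
      positivity
    nlinarith

end CirculantLowerBounds

/-! ### Greedy colouring -/

section GreedyColouring

theorem exists_greedy_colouring {V : Type*} [Finite V] (r : V → V → Prop)
    (hr : ∀ x y, r x y → r y x) {k : ℕ} (hk : ∀ x, {y | y ≠ x ∧ r x y}.ncard < k) :
    ∃ c : V → Fin k, ∀ x y, x ≠ y → r x y → c x ≠ c y := by
  classical
  have := Fintype.ofFinite V
  rcases isEmpty_or_nonempty V with hV | ⟨⟨v₀⟩⟩
  · exact ⟨fun x => (hV.false x).elim, fun x => (hV.false x).elim⟩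
  suffices h : ∀ T : Finset V, ∃ c : V → Fin k, ∀ x ∈ T, ∀ y ∈ T, x ≠ y → r x y → c x ≠ c y by
    obtain ⟨c, hc⟩ := h Finset.univ
    exact ⟨c, fun x y => hc x (Finset.mem_univ _) y (Finset.mem_univ _)⟩
  intro T
  induction T using Finset.induction_on with
  | empty => exact ⟨fun _ => ⟨0, (Nat.zero_le _).trans_lt (hk v₀)⟩, by simp⟩
  | insert a T ha ih =>
    obtain ⟨c, hc⟩ := ih
    let N : Finset V := Finset.univ.filter fun y => y ≠ a ∧ r a y
    have hN : N.card < k := by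
      have := hk a
      rwa [show {y | y ≠ a ∧ r a y} = (N : Set V) by ext; simp [N], Set.ncard_coe_finset] at this
    obtain ⟨f, hf⟩ : ∃ f : Fin k, f ∉ N.image c := by
      by_contra! h
      have h1 : (Finset.univ : Finset (Fin k)) ⊆ N.image c := fun f _ => h f
      have h2 := (Finset.card_le_card h1).trans Finset.card_image_le
      simp only [Finset.card_univ, Fintype.card_fin] at h2
      omega
    have hfa : ∀ y, y ≠ a → r a y → c y ≠ f := fun y hy hry h =>
      hf (Finset.mem_image.2 ⟨y, by simp [N, hy, hry], h⟩)
    refine ⟨Function.update c a f, ?_⟩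
    intro x hx y hy hxy hrxy
    by_cases hxa : x = a
    · subst hxa
      rw [Function.update_self, Function.update_of_ne hxy.symm]
      exact (hfa y hxy.symm hrxy).symm
    · by_cases hya : y = a
      · subst hya
        rw [Function.update_self, Function.update_of_ne hxy]
        exact hfa x hxy (hr _ _ hrxy)
      · rw [Function.update_of_ne hxa, Function.update_of_ne hya]
        exact hc x ((Finset.mem_insert.1 hx).resolve_left hxa) y
          ((Finset.mem_insert.1 hy).resolve_left hya) hxy hrxy

end GreedyColouring

/-! ### Colouring the translates of one path -/

section ClassColouring

variable {n s a b : ℕ}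

/-- The starting points `x`, `y` are close enough for two translates of a path with `a` unit steps
and `b` steps of size `s` to share an edge. -/
def ClassConflict (n s a b : ℕ) (x y : ZMod n) : Prop :=
  (∃ k : ℤ, |k| < a ∧ x - y = k) ∨ ∃ k : ℤ, |k| < b ∧ x - y = k * s

theorem ClassConflict.symm {x y : ZMod n} (h : ClassConflict n s a b x y) :
    ClassConflict n s a b y x := by
  rcases h with ⟨k, hk, h⟩ | ⟨k, hk, h⟩
  · exact Or.inl ⟨-k, by rwa [abs_neg], by rw [← neg_sub, h]; push_cast; ring⟩
  · exact Or.inr ⟨-k, by rwa [abs_neg], by rw [← neg_sub, h]; push_cast; ring⟩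

theorem ncard_classConflict_lt [NeZero n] (hab : 0 < a + b) (x : ZMod n) :
    {y | y ≠ x ∧ ClassConflict n s a b x y}.ncard < 2 * a + 2 * b := by
  classical
  let N : Finset (ZMod n) := (Finset.Ioo (-(a : ℤ)) a).image (fun k : ℤ => x - k) ∪
    (Finset.Ioo (-(b : ℤ)) b).image (fun k : ℤ => x - k * s)
  have hsub : {y | y ≠ x ∧ ClassConflict n s a b x y} ⊆ (N : Set (ZMod n)) := by
    rintro y ⟨-, ⟨k, hk, h⟩ | ⟨k, hk, h⟩⟩
    · exact Finset.mem_coe.2 (Finset.mem_union_left _ (Finset.mem_image.2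
        ⟨k, Finset.mem_Ioo.2 (abs_lt.1 hk), by rw [← h]; ring⟩))
    · exact Finset.mem_coe.2 (Finset.mem_union_right _ (Finset.mem_image.2
        ⟨k, Finset.mem_Ioo.2 (abs_lt.1 hk), by rw [← h]; ring⟩))
  have h1 := Set.ncard_le_ncard hsub
  rw [Set.ncard_coe_finset] at h1
  have h2 : N.card ≤ _ + _ := Finset.card_union_le _ _
  have h3 : ((Finset.Ioo (-(a : ℤ)) a).image (fun k : ℤ => x - (k : ZMod n))).card ≤ 2 * a - 1 :=
    Finset.card_image_le.trans (by rw [Int.card_Ioo]; omega)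
  have h4 : ((Finset.Ioo (-(b : ℤ)) b).image (fun k : ℤ => x - (k : ZMod n) * s)).card
      ≤ 2 * b - 1 := Finset.card_image_le.trans (by rw [Int.card_Ioo]; omega)
  omega

/-- A sequence increasing by one at each step, with extra jumps `J₀` and `J₁` in every period
of length `s`. -/
def jumpSeq (s J₀ J₁ x : ℕ) : ℕ := x + J₀ * (x / s) + J₁ * ((x + s / 2) / s)

theorem jumpSeq_add_mul (hs : 0 < s) (J₀ J₁ x k : ℕ) :
    jumpSeq s J₀ J₁ (x + k * s) = jumpSeq s J₀ J₁ x + k * (s + J₀ + J₁) := by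
  unfold jumpSeq
  rw [show x + k * s + s / 2 = x + s / 2 + k * s by ring, Nat.add_mul_div_right _ _ hs,
    Nat.add_mul_div_right _ _ hs]
  ring

/-- The two kinds of jump alternate at distance at least `s / 2`, so a stretch of fewer than `s / 2`
unit steps meets at most one jump. -/
theorem jumpSeq_add_le (hs : 0 < s) {J₀ J₁ J k : ℕ} (h₀ : J₀ ≤ J) (h₁ : J₁ ≤ J) (hk : k < s / 2)
    (x : ℕ) : jumpSeq s J₀ J₁ x + k ≤ jumpSeq s J₀ J₁ (x + k) ∧
      jumpSeq s J₀ J₁ (x + k) ≤ jumpSeq s J₀ J₁ x + k + J := by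
  have key : ∀ y, y / s ≤ (y + k) / s ∧ (y + k) / s ≤ y / s + 1 := by
    intro y
    refine ⟨Nat.div_le_div_right (by omega), ?_⟩
    rw [← Nat.add_div_right _ hs]
    exact Nat.div_le_div_right (by omega)
  have k1 := key x
  have k2 := key (x + s / 2)
  have e : x + k + s / 2 = x + s / 2 + k := by ring
  unfold jumpSeq
  rw [e]
  have k3 : ¬ ((x + k) / s = x / s + 1 ∧ (x + s / 2 + k) / s = (x + s / 2) / s + 1) := by
    rintro ⟨h1, h2⟩
    have m1 := Nat.div_mul_le_self (x + k) s
    have m2 := Nat.div_mul_le_self (x + s / 2 + k) s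
    have m3 := Nat.lt_div_mul_add hs (a := x)
    have m4 := Nat.lt_div_mul_add hs (a := x + s / 2)
    have m5 : x / s ≤ (x + s / 2) / s := Nat.div_le_div_right (by omega)
    rw [h1, add_mul] at m1
    rw [h2, add_mul] at m2
    rcases Nat.eq_or_lt_of_le m5 with h | h
    · rw [← h] at m4
      omega
    · have m6 : (x / s + 1) * s ≤ (x + s / 2) / s * s := Nat.mul_le_mul_right s h
      rw [add_mul] at m6
      omega
  obtain ⟨k1a, k1b⟩ := k1
  obtain ⟨k2a, k2b⟩ := k2
  rcases Nat.eq_or_lt_of_le k1b with h1 | h1 <;> rcases Nat.eq_or_lt_of_le k2b with h2 | h2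
  · exact (k3 ⟨h1, h2⟩).elim
  · rw [h1, show (x + s / 2 + k) / s = (x + s / 2) / s by omega, mul_add]
    omega
  · rw [h2, show (x + k) / s = x / s by omega, mul_add]
    omega
  · rw [show (x + k) / s = x / s by omega, show (x + s / 2 + k) / s = (x + s / 2) / s by omega]
    omega

/-- The total jump can be reduced to some `t ≤ b - 1 ≤ 2(b - a)`, whose two halves both fit under `b
- a`. This is where `2a ≤ b + 1` enters. -/
theorem exists_jumps (hab : 2 * a ≤ b + 1) (hb : 0 < b) (s : ℕ) :
    ∃ J₀ J₁ : ℕ, J₀ ≤ b - a ∧ J₁ ≤ b - a ∧ s + J₀ + J₁ ≡ 1 [MOD b] := by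
  obtain ⟨t, ht, hmod⟩ : ∃ t < b, s + t ≡ 1 [MOD b] := by
    -- The residue of `1 - s`, with `(b - 1) * s` standing for `-s`.
    refine ⟨((b - 1) * s + 1) % b, Nat.mod_lt _ hb, ?_⟩
    have h1 : s + ((b - 1) * s + 1) % b ≡ s + ((b - 1) * s + 1) [MOD b] :=
      Nat.ModEq.add_left _ (Nat.mod_modEq _ _)
    obtain ⟨c, rfl⟩ := Nat.exists_eq_add_of_lt hb
    have h2 : s + ((0 + c + 1 - 1) * s + 1) = (0 + c + 1) * s + 1 := by
      simp only [Nat.add_sub_cancel]; ring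
    rw [h2] at h1
    exact h1.trans (by simp [Nat.ModEq])
  refine ⟨t / 2, t - t / 2, by omega, by omega, ?_⟩
  rwa [show s + t / 2 + (t - t / 2) = s + t by omega]

theorem ZMod.natCast_sub_eq_intCast {X Y : ℕ} {k : ℤ}
    (h : (X : ZMod n) - (Y : ZMod n) = (k : ZMod n)) (hlt : |(X : ℤ) - Y| + |k| < n) :
    (X : ℤ) - Y = k := by
  have h1 : (((X : ℤ) - Y - k : ℤ) : ZMod n) = 0 := by
    push_cast
    rw [h, sub_self]
  rw [ZMod.intCast_zmod_eq_zero_iff_dvd] at h1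
  have h2 : |(X : ℤ) - Y - k| < n := (abs_sub _ _).trans_lt hlt
  have := Int.eq_zero_of_abs_lt_dvd h1 h2
  linarith

/-- The colour is `jumpSeq` modulo `b`, in one of two palettes. A long step adds `1` modulo `b`, so
fewer than `b` of them change the residue. A run of `k` unit steps with `0 < k < a` adds between `1`
and `(a - 1) + (b - a) = b - 1`, so it changes the residue too. -/
theorem exists_classColouring_two_mul [NeZero n] (hs : 1 < s) (ha : a ≤ s / 2)
    (hab : 2 * a ≤ b + 1) (hb : 0 < b) (hsn : s ≤ n) (hbn : 2 * ((b - 1) * s) ≤ n) :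
    ∃ c : ZMod n → Fin (2 * b), ∀ x y, x ≠ y → ClassConflict n s a b x y → c x ≠ c y := by
  obtain ⟨J₀, J₁, h₀, h₁, hJ⟩ := exists_jumps hab hb s
  -- `K` bounds every conflicting offset. Changing palette on the last `K` residues keeps
  -- representatives in one palette closer than `n - K`, so a conflict modulo `n` is an equality of
  -- integers.
  set K := max (a - 1) ((b - 1) * s) with hKdef
  have hK : 2 * K ≤ n := by omega
  let f : ZMod n → ℕ := fun x => jumpSeq s J₀ J₁ x.val % b
  have hf : ∀ x, f x < b := fun x => Nat.mod_lt _ hb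
  let g : ZMod n → ℕ := fun x => if x.val < n - K then 0 else b
  refine ⟨fun x => ⟨g x + f x, ?_⟩, ?_⟩
  · have := hf x
    simp only [g]
    split_ifs <;> omega
  intro x y hxy hconf heq
  replace heq : g x + f x = g y + f y := congrArg Fin.val heq
  have hpal : (x.val < n - K ↔ y.val < n - K) ∧ f x = f y := by
    have := hf x
    have := hf y
    simp only [g] at heq
    split_ifs at heq with h1 h2 h2 <;> constructor <;> omega
  wlog hlt : y.val < x.val generalizing x y
  · refine this y x hxy.symm hconf.symm heq.symm ⟨hpal.1.symm, hpal.2.symm⟩ ?_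
    exact lt_of_le_of_ne (not_lt.1 hlt) fun h => hxy (ZMod.val_injective n h)
  obtain ⟨hpal, hfxy⟩ := hpal
  have hx := ZMod.val_lt x
  obtain ⟨d, hd⟩ := Nat.exists_eq_add_of_lt hlt
  have hdK : d + 1 + K < n := by
    by_cases h : x.val < n - K
    · omega
    · have : ¬ y.val < n - K := fun h' => h (hpal.2 h')
      omega
  have hvx : ((x.val : ℕ) : ZMod n) = x := ZMod.natCast_zmod_val x
  have hvy : ((y.val : ℕ) : ZMod n) = y := ZMod.natCast_zmod_val y
  have hmod : jumpSeq s J₀ J₁ x.val ≡ jumpSeq s J₀ J₁ y.val [MOD b] := hfxy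
  have habs : |(x.val : ℤ) - y.val| = d + 1 := by rw [hd]; push_cast; rw [abs_of_nonneg] <;> linarith
  rcases hconf with ⟨k, hk, h⟩ | ⟨k, hk, h⟩
  · rw [← hvx, ← hvy] at h
    have := ZMod.natCast_sub_eq_intCast h (by rw [habs]; omega)
    have hda : d + 1 < a := by rw [← this, habs] at hk; omega
    have hj := jumpSeq_add_le (by omega : 0 < s) h₀ h₁ (k := d + 1) (by omega) y.val
    rw [show y.val + (d + 1) = x.val by omega] at hj
    have := (Nat.modEq_iff_dvd' (by omega)).1 hmod.symm
    have := Nat.le_of_dvd (by omega) this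
    omega
  · rw [← hvx, ← hvy] at h
    have hks : |k * s| ≤ K := by
      have h1 : |k * (s : ℤ)| = |k| * s := by rw [abs_mul, Nat.abs_cast]
      have h2 : |k| * s ≤ ((b - 1 : ℕ) : ℤ) * s := by
        apply mul_le_mul_of_nonneg_right _ (by positivity)
        omega
      have h3 : (((b - 1) * s : ℕ) : ℤ) ≤ K := by exact_mod_cast le_max_right _ _
      push_cast at h3
      rw [h1]
      exact h2.trans h3
    have hxyk := ZMod.natCast_sub_eq_intCast (k := k * s) (by rw [h]; push_cast; rfl)
      (by rw [habs]; omega)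
    have hkpos : 0 < k := by
      by_contra hneg
      have : k * (s : ℤ) ≤ 0 := mul_nonpos_of_nonpos_of_nonneg (not_lt.1 hneg) (by positivity)
      omega
    obtain ⟨j, rfl⟩ := Int.eq_ofNat_of_zero_le hkpos.le
    have hxj : x.val = y.val + j * s := by
      have : (x.val : ℤ) = y.val + j * s := by linarith
      exact_mod_cast this
    rw [hxj, jumpSeq_add_mul (by omega)] at hmod
    have h2 : jumpSeq s J₀ J₁ y.val + j * (s + J₀ + J₁) ≡ jumpSeq s J₀ J₁ y.val + j * 1 [MOD b] :=
      Nat.ModEq.add_left _ (Nat.ModEq.mul_left _ hJ)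
    have h3 := h2.symm.trans hmod
    have h4 := (Nat.modEq_iff_dvd' (by omega)).1 h3.symm
    rw [Nat.add_sub_cancel_left, mul_one] at h4
    have := Nat.le_of_dvd (by omega) h4
    rw [abs_of_pos hkpos] at hk
    omega

/-- The number of colours used on the translates of a path with `a` unit steps and `b` steps of
size `s`. -/
def classCost (a b : ℕ) : ℕ := if 2 * a ≤ b + 1 then 2 * b else 2 * a + 2 * b

theorem exists_classColouring [NeZero n] (hs : 1 < s) (ha : a ≤ s / 2)
    (hab : 0 < a + b) (hsn : s ≤ n) (hbn : 2 * ((b - 1) * s) ≤ n) :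
    ∃ c : ZMod n → Fin (classCost a b),
      ∀ x y, x ≠ y → ClassConflict n s a b x y → c x ≠ c y := by
  by_cases h : 2 * a ≤ b + 1
  · rw [classCost, if_pos h]
    exact exists_classColouring_two_mul hs ha h (by omega) hsn hbn
  · rw [classCost, if_neg h]
    exact exists_greedy_colouring _ (fun _ _ => ClassConflict.symm) (ncard_classConflict_lt hab)

end ClassColouring

/-! ### Routing by long steps followed by unit steps -/

section CirculantRouting

variable {n s : ℕ}

theorem ZMod.natCast_injOn_lt {i j : ℕ} (hi : i < n) (hj : j < n) (h : (i : ZMod n) = j) :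
    i = j := by
  rw [ZMod.natCast_eq_natCast_iff] at h
  exact Nat.ModEq.eq_of_lt_of_lt h hi hj

theorem circulantOneS_adj_add_one (hn : 1 < n) (v : ZMod n) :
    (circulantOneS n s).Adj v (v + (1 : ℕ)) := by
  have h1 : (1 : ZMod n) ≠ 0 := fun h =>
    absurd (ZMod.natCast_injOn_lt (n := n) (i := 1) (j := 0) hn (by omega) (by simpa using h))
      (by omega)
  simp [circulantOneS, SimpleGraph.circulantGraph_adj, h1]

theorem circulantOneS_adj_add (hs : 0 < s) (hsn : s < n) (v : ZMod n) :
    (circulantOneS n s).Adj v (v + (s : ℕ)) := by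
  have h1 : (s : ZMod n) ≠ 0 := fun h =>
    absurd (ZMod.natCast_injOn_lt (n := n) (i := s) (j := 0) hsn (by omega) (by simpa using h))
      (by omega)
  simp [circulantOneS, SimpleGraph.circulantGraph_adj, h1]

theorem exists_walk_of_steps {G : SimpleGraph (ZMod n)} {c : ℕ}
    (hc : ∀ v : ZMod n, G.Adj v (v + c)) (x : ZMod n) (k : ℕ) :
    ∃ w : G.Walk x (x + k * c), ∀ e ∈ w.edges, ∃ j < k, e = s(x + j * c, x + j * c + c) := by
  induction k with
  | zero => exact ⟨SimpleGraph.Walk.nil.copy rfl (by simp), by simp⟩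
  | succ k ih =>
    obtain ⟨w, hw⟩ := ih
    refine ⟨(w.concat (hc _)).copy rfl (by push_cast; ring), ?_⟩
    intro e he
    rw [SimpleGraph.Walk.edges_copy, SimpleGraph.Walk.edges_concat, List.concat_eq_append,
      List.mem_append, List.mem_singleton] at he
    rcases he with he | he
    · obtain ⟨j, hj, h⟩ := hw e he
      exact ⟨j, by omega, h⟩
    · exact ⟨k, by omega, he⟩

theorem exists_path_of_steps [NeZero n] (hs : 0 < s) (hsn : 2 * s < n) {x y : ZMod n} (b : ℕ)
    (a : ℤ) (hy : y = x + b * s + a) :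
    ∃ w : (circulantOneS n s).Path x y, ∀ e ∈ w.1.edges,
      (∃ j < b, e = s(x + (j : ZMod n) * (s : ℕ), x + (j : ZMod n) * (s : ℕ) + (s : ℕ))) ∨
      ∃ j < a.natAbs, e = s(x + (b * s + (min a 0 : ℤ)) + (j : ZMod n) * (1 : ℕ),
        x + (b * s + (min a 0 : ℤ)) + (j : ZMod n) * (1 : ℕ) + (1 : ℕ)) := by
  suffices h : ∃ w : (circulantOneS n s).Walk x y, ∀ e ∈ w.edges,
      (∃ j < b, e = s(x + (j : ZMod n) * (s : ℕ), x + (j : ZMod n) * (s : ℕ) + (s : ℕ))) ∨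
      ∃ j < a.natAbs, e = s(x + (b * s + (min a 0 : ℤ)) + (j : ZMod n) * (1 : ℕ),
        x + (b * s + (min a 0 : ℤ)) + (j : ZMod n) * (1 : ℕ) + (1 : ℕ)) by
    obtain ⟨w, hw⟩ := h
    -- Shortcutting to a path only deletes edges, so it suffices to build a walk.
    exact ⟨w.toPath, fun e he => hw e (SimpleGraph.Walk.edges_toPath_subset_edges w he)⟩
  obtain ⟨w₁, hw₁⟩ := exists_walk_of_steps (circulantOneS_adj_add (n := n) hs (by omega)) x b
  rcases le_total 0 a with ha | ha
  · obtain ⟨m, rfl⟩ := Int.eq_ofNat_of_zero_le ha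
    obtain ⟨w₂, hw₂⟩ := exists_walk_of_steps (circulantOneS_adj_add_one (n := n) (s := s) (by omega))
      (x + b * s) m
    refine ⟨(w₁.append w₂).copy rfl (by rw [hy]; push_cast; ring), ?_⟩
    intro e he
    rw [SimpleGraph.Walk.edges_copy, SimpleGraph.Walk.edges_append, List.mem_append] at he
    rcases he with he | he
    · exact Or.inl (hw₁ e he)
    · obtain ⟨j, hj, h⟩ := hw₂ e he
      refine Or.inr ⟨j, by simpa using hj, ?_⟩
      rw [h, min_eq_right ha]
      simp
  · obtain ⟨m, hm⟩ := Int.eq_ofNat_of_zero_le (neg_nonneg.2 ha)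
    obtain rfl : a = -(m : ℤ) := by linarith
    -- For negative `a` the unit part is built upwards from `y` and then reversed, so its edges
    -- start at the offset `b * s + min a 0`.
    obtain ⟨w₂, hw₂⟩ := exists_walk_of_steps (circulantOneS_adj_add_one (n := n) (s := s) (by omega))
      y m
    refine ⟨w₁.append (w₂.reverse.copy (by rw [hy]; push_cast; ring) rfl), ?_⟩
    intro e he
    rw [SimpleGraph.Walk.edges_append, List.mem_append, SimpleGraph.Walk.edges_copy,
      SimpleGraph.Walk.edges_reverse, List.mem_reverse] at he
    rcases he with he | he
    · exact Or.inl (hw₁ e he)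
    · obtain ⟨j, hj, h⟩ := hw₂ e he
      refine Or.inr ⟨j, by simpa using hj, ?_⟩
      rw [h, min_eq_left ha, hy, add_assoc x]

/-- Matching the ends crosswise would force `c + c' = 0` modulo `n`. -/
theorem eq_and_eq_of_edge_eq {c c' : ℕ} (hc : 0 < c) (hc' : 0 < c') (hcc : c + c' < n)
    {u v : ZMod n} (h : s(u, u + (c : ZMod n)) = s(v, v + (c' : ZMod n))) : c = c' ∧ u = v := by
  rw [Sym2.eq_iff] at h
  rcases h with ⟨h1, h2⟩ | ⟨h1, h2⟩
  · rw [h1] at h2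
    exact ⟨ZMod.natCast_injOn_lt (by omega) (by omega) (add_left_cancel h2), h1⟩
  · exfalso
    have h3 : ((c + c' : ℕ) : ZMod n) = (0 : ℕ) := by
      rw [h1, add_assoc] at h2
      push_cast
      rw [add_comm]
      simpa using h2
    have := ZMod.natCast_injOn_lt hcc (by omega) h3
    omega

theorem classConflict_of_common_edge (hs : 1 < s) (hsn : 2 * s < n) {x x' d : ZMod n} {a b : ℕ}
    {e : Sym2 (ZMod n)}
    (h : (∃ j < b, e = s(x + (j : ZMod n) * (s : ℕ), x + (j : ZMod n) * (s : ℕ) + (s : ℕ))) ∨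
      ∃ j < a, e = s(x + d + (j : ZMod n) * (1 : ℕ), x + d + (j : ZMod n) * (1 : ℕ) + (1 : ℕ)))
    (h' : (∃ j < b, e = s(x' + (j : ZMod n) * (s : ℕ), x' + (j : ZMod n) * (s : ℕ) + (s : ℕ))) ∨
      ∃ j < a, e = s(x' + d + (j : ZMod n) * (1 : ℕ),
        x' + d + (j : ZMod n) * (1 : ℕ) + (1 : ℕ))) :
    ClassConflict n s a b x x' := by
  rcases h with ⟨j, hj, rfl⟩ | ⟨j, hj, rfl⟩ <;> rcases h' with ⟨j', hj', h'⟩ | ⟨j', hj', h'⟩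
  · have := (eq_and_eq_of_edge_eq (by omega) (by omega) (by omega) h').2
    refine Or.inr ⟨(j' : ℤ) - j, by rw [abs_lt]; omega, ?_⟩
    push_cast
    linear_combination this
  · have := (eq_and_eq_of_edge_eq (by omega) (by omega) (by omega) h').1
    omega
  · have := (eq_and_eq_of_edge_eq (by omega) (by omega) (by omega) h').1
    omega
  · have := (eq_and_eq_of_edge_eq (by omega) (by omega) (by omega) h').2
    refine Or.inl ⟨(j' : ℤ) - j, by rw [abs_lt]; omega, ?_⟩
    push_cast at this ⊢
    linear_combination this

/-- The number of steps of size `s` used for the displacement `δ`. -/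
def longSteps (s δ : ℕ) : ℕ := (δ + s / 2) / s

/-- The signed number of unit steps used for the displacement `δ`. -/
def unitSteps (s δ : ℕ) : ℤ := (δ : ℤ) - longSteps s δ * s

theorem longSteps_mul_le (s δ : ℕ) : longSteps s δ * s ≤ δ + s / 2 := Nat.div_mul_le_self _ _

theorem lt_longSteps_mul_add (hs : 0 < s) (δ : ℕ) : δ + s / 2 < longSteps s δ * s + s :=
  Nat.lt_div_mul_add hs

theorem natAbs_unitSteps_le (hs : 0 < s) (δ : ℕ) : (unitSteps s δ).natAbs ≤ s / 2 := by
  have h1 := longSteps_mul_le s δ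
  have h2 := lt_longSteps_mul_add hs δ
  unfold unitSteps
  rw [← Nat.cast_mul]
  omega

/-- The number of colours used for all requests of displacement `δ`. -/
def displacementCost (s δ : ℕ) : ℕ := classCost (unitSteps s δ).natAbs (longSteps s δ)

theorem exists_displacementColouring [NeZero n] (hs : 1 < s) (hsn : 2 * s < n) {δ : ℕ}
    (hδ : 0 < δ) (hδn : 2 * δ ≤ n) :
    ∃ c : ZMod n → Fin (displacementCost s δ), ∀ x y, x ≠ y →
      ClassConflict n s (unitSteps s δ).natAbs (longSteps s δ) x y → c x ≠ c y := by
  refine exists_classColouring hs (natAbs_unitSteps_le (by omega) δ) ?_ (by omega) ?_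
  · rcases Nat.eq_zero_or_pos (longSteps s δ) with h | h
    · have : unitSteps s δ = δ := by simp [unitSteps, h]
      rw [this, Int.natAbs_natCast]
      omega
    · omega
  · have h1 := longSteps_mul_le s δ
    rw [Nat.sub_mul]
    omega

/-- The displacement of a request. -/
def Request.displacement (p : Request (ZMod n)) : ℕ := (p.1.2 - p.1.1).val

/-- One of the two orientations of each pair of distinct nodes. -/
def IsForward (p : Request (ZMod n)) : Prop :=
  2 * p.displacement < n ∨ (2 * p.displacement = n ∧ p.1.1.val < p.1.2.val)

theorem Request.displacement_pos (p : Request (ZMod n)) : 0 < p.displacement := by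
  refine Nat.pos_of_ne_zero fun h => p.2 ?_
  rw [Request.displacement, ZMod.val_eq_zero, sub_eq_zero] at h
  exact h.symm

theorem Request.displacement_swap [NeZero n] (p : Request (ZMod n)) :
    p.swap.displacement + p.displacement = n := by
  have h0 : p.1.2 - p.1.1 ≠ 0 := fun h => p.2 (sub_eq_zero.1 h).symm
  have := ZMod.val_lt (p.1.2 - p.1.1)
  have h : p.swap.displacement = (-(p.1.2 - p.1.1)).val := by
    rw [neg_sub]; rfl
  rw [h, ZMod.neg_val, if_neg h0, Request.displacement]
  omega

theorem isForward_swap [NeZero n] (p : Request (ZMod n)) : IsForward p.swap ↔ ¬ IsForward p := by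
  have h1 := p.displacement_swap
  have h2 : p.1.1.val ≠ p.1.2.val := fun h => p.2 (ZMod.val_injective n h)
  have h3 : p.swap.1.1 = p.1.2 := rfl
  have h4 : p.swap.1.2 = p.1.1 := rfl
  unfold IsForward
  rw [h3, h4]
  omega

theorem exists_routing [NeZero n] (hs : 0 < s) (hsn : 2 * s < n) :
    ∃ Q : Routing (circulantOneS n s), ∀ p, ∀ e ∈ (Q p).1.edges,
      (∃ j < longSteps s p.displacement, e = s(p.1.1 + (j : ZMod n) * (s : ℕ),
        p.1.1 + (j : ZMod n) * (s : ℕ) + (s : ℕ))) ∨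
      ∃ j < (unitSteps s p.displacement).natAbs,
        e = s(p.1.1 + (longSteps s p.displacement * s + (min (unitSteps s p.displacement) 0 : ℤ))
            + (j : ZMod n) * (1 : ℕ),
          p.1.1 + (longSteps s p.displacement * s + (min (unitSteps s p.displacement) 0 : ℤ))
            + (j : ZMod n) * (1 : ℕ) + (1 : ℕ)) := by
  have h : ∀ p : Request (ZMod n), p.1.2 = p.1.1 + longSteps s p.displacement * s
      + ((unitSteps s p.displacement : ℤ) : ZMod n) := by
    intro p
    have : ((p.displacement : ℕ) : ZMod n) = p.1.2 - p.1.1 := ZMod.natCast_zmod_val _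
    unfold unitSteps
    push_cast
    rw [this]
    ring
  choose Q hQ using fun p : Request (ZMod n) => exists_path_of_steps hs hsn _ _ (h p)
  exact ⟨Q, hQ⟩

theorem forwardRequest_mem {V : Type*} {F : Request V → Prop} (hF : ∀ p, F p.swap ↔ ¬ F p)
    (p : Request V) : F (forwardRequest F p) := by
  by_cases h : F p
  · rwa [forwardRequest_of_pos h]
  · rw [forwardRequest_of_neg h]
    exact (hF p).2 h

/-- Different displacements use disjoint palettes, modelled by a sigma type, so the costs add.
Within one displacement a request is determined by its starting point, which is what gets coloured.
-/
theorem opticalIndex_le_sum_displacementCost [NeZero n] (hs : 1 < s) (hsn : 2 * s < n) :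
    directedOpticalIndex (circulantOneS n s) ≤
        ∑ δ ∈ Finset.Icc 1 (n / 2), displacementCost s δ ∧
      undirectedOpticalIndex (circulantOneS n s) ≤
        2 * ∑ δ ∈ Finset.Icc 1 (n / 2), displacementCost s δ := by
  obtain ⟨Q, hQ⟩ := exists_routing (n := n) (s := s) (by omega) hsn
  have hI : ∀ δ : ↥(Finset.Icc 1 (n / 2)), 0 < δ.1 ∧ 2 * δ.1 ≤ n := fun δ => by
    have := Finset.mem_Icc.1 δ.2
    omega
  choose col hcol using fun δ : ↥(Finset.Icc 1 (n / 2)) => exists_displacementColouring hs hsn (hI δ).1 (hI δ).2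
  have hmem : ∀ p : Request (ZMod n), IsForward p → p.displacement ∈ Finset.Icc 1 (n / 2) := by
    intro p hp
    have := p.displacement_pos
    unfold IsForward at hp
    rw [Finset.mem_Icc]
    omega
  let c₀ : {p : Request (ZMod n) // IsForward p} → Σ δ : ↥(Finset.Icc 1 (n / 2)), Fin (displacementCost s δ.1) := fun p =>
    ⟨⟨p.1.displacement, hmem p.1 p.2⟩, col ⟨p.1.displacement, hmem p.1 p.2⟩ p.1.1.1⟩
  have hκ : Fintype.card (Σ δ : ↥(Finset.Icc 1 (n / 2)), Fin (displacementCost s δ.1))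
      = ∑ δ ∈ Finset.Icc 1 (n / 2), displacementCost s δ := by
    rw [Fintype.card_sigma]
    simp only [Fintype.card_fin]
    exact Finset.sum_coe_sort (Finset.Icc 1 (n / 2)) (displacementCost s)
  rw [← hκ]
  refine opticalIndex_le_of_half Q IsForward isForward_swap
    (fun p => Fintype.equivFin _ (c₀ ⟨forwardRequest IsForward p,
      forwardRequest_mem isForward_swap p⟩)) ?_
  rintro p p' hp hp' hne ⟨e, he, he'⟩ heq
  have heq := (Fintype.equivFin _).injective heq
  simp only [forwardRequest_of_pos hp, forwardRequest_of_pos hp'] at heq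
  simp only [c₀] at heq
  rw [Sigma.mk.injEq] at heq
  obtain ⟨hδ, hc⟩ := heq
  have hδ' : p.displacement = p'.displacement := congrArg Subtype.val hδ
  have hpe := hQ p e he
  have hpe' := hQ p' e he'
  rw [← hδ'] at hpe'
  have hconf := classConflict_of_common_edge hs hsn hpe hpe'
  have hne1 : p.1.1 ≠ p'.1.1 := by
    intro h
    refine hne (Subtype.ext (Prod.ext h ?_))
    have h2 : p.1.2 - p.1.1 = p'.1.2 - p'.1.1 := ZMod.val_injective n hδ'
    rw [h] at h2
    exact sub_left_injective h2
  refine hcol ⟨p.displacement, hmem p hp⟩ _ _ hne1 hconf ?_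
  have key : ∀ (i j : ↥(Finset.Icc 1 (n / 2))) (x y : ZMod n), i = j → HEq (col i x) (col j y) → col i x = col i y := by
    rintro i _ x y rfl h
    exact eq_of_heq h
  exact key _ _ _ _ hδ hc

end CirculantRouting

/-! ### Summing the costs over all displacements -/

section CostSums

theorem classCost_le (a b : ℕ) : classCost a b ≤ 2 * a + 2 * b := by
  unfold classCost; split_ifs <;> omega

/-- Total cost of all classes with `1 ≤ a ≤ h` unit steps and `1 ≤ b ≤ B` long steps. -/
def costSum (h B : ℕ) : ℕ := ∑ b ∈ Finset.range B, ∑ a ∈ Finset.range h, classCost (a + 1) (b + 1)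

/-- The surcharge `2(a + 1)` over the base cost `2(b + 1)` is paid only for `b < 2a`. -/
theorem sum_classCost_le_min (a B : ℕ) :
    ∑ b ∈ Finset.range B, classCost (a + 1) (b + 1) ≤
      B * (B + 1) + 2 * ((a + 1) * min B (2 * a)) := by
  induction B with
  | zero => simp
  | succ B ih =>
    rw [Finset.sum_range_succ]
    unfold classCost at ih ⊢
    have e : (B + 1) * (B + 1 + 1) = B * (B + 1) + 2 * (B + 1) := by ring
    split_ifs with h
    · rw [min_eq_right (by omega)] at ih ⊢
      omega
    · rw [min_eq_left (by omega)] at ih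
      rw [min_eq_left (by omega), mul_add (a + 1) B 1]
      omega

theorem costSum_le (h B : ℕ) :
    (costSum h B : ℝ) ≤ h * (B * (B + 1)) + B * (h * (h + 1)) := by
  have h1 : costSum h B ≤ ∑ b ∈ Finset.range B, ∑ a ∈ Finset.range h, (2 * (a + 1) + 2 * (b + 1)) :=
    Finset.sum_le_sum fun b _ => Finset.sum_le_sum fun a _ => classCost_le _ _
  have h2 : ∀ m : ℕ, ∑ i ∈ Finset.range m, 2 * (i + 1) = m * (m + 1) := by
    intro m
    induction m with
    | zero => simp
    | succ m ih => rw [Finset.sum_range_succ, ih]; ring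
  simp only [Finset.sum_add_distrib, Finset.sum_const, Finset.card_range, smul_eq_mul, h2] at h1
  rw [← Finset.mul_sum, h2] at h1
  have : (costSum h B : ℝ) ≤ ((B * (h * (h + 1)) + h * (B * (B + 1)) : ℕ) : ℝ) := by
    exact_mod_cast h1
  push_cast at this
  linarith

theorem costSum_le_of_long (h B : ℕ) :
    (costSum h B : ℝ) ≤ h * (B * (B + 1)) + (B - 2) * (h * (h + 1)) / 2
      + h * (h + 1) * (2 * h + 1) / 3 := by
  have h1 : (costSum h B : ℝ) ≤
      ∑ a ∈ Finset.range h, ((B : ℝ) * (B + 1) + (a + 1) * (B + 2 * a)) := by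
    unfold costSum
    rw [Finset.sum_comm, Nat.cast_sum]
    refine Finset.sum_le_sum fun a _ => ?_
    have h2 := sum_classCost_le_min a B
    -- Twice the minimum is at most the sum, which makes the bound polynomial in both parameters.
    have h3 : (a + 1) * (2 * min B (2 * a)) ≤ (a + 1) * (B + 2 * a) :=
      Nat.mul_le_mul_left _ (by omega)
    have h4 : ∑ b ∈ Finset.range B, classCost (a + 1) (b + 1) ≤
        B * (B + 1) + (a + 1) * (B + 2 * a) := by
      rw [mul_left_comm] at h3
      omega
    exact_mod_cast h4
  refine h1.trans (le_of_eq ?_)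
  clear h1
  induction h with
  | zero => simp
  | succ h ih => rw [Finset.sum_range_succ, ih]; push_cast; ring

theorem unitSteps_add (s δ : ℕ) : (δ : ℤ) = unitSteps s δ + longSteps s δ * s := by
  unfold unitSteps; ring

/-- The parameters `(b, |a|)` of a displacement. -/
def stepPair (s δ : ℕ) : ℕ × ℕ := (longSteps s δ, (unitSteps s δ).natAbs)

theorem sum_displacementCost_le_of_injOn {s : ℕ} {D : Finset ℕ} (hD : Set.InjOn (stepPair s) D)
    (T : Finset (ℕ × ℕ)) (hT : ∀ δ ∈ D, stepPair s δ ∈ T) :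
    ∑ δ ∈ D, displacementCost s δ ≤ ∑ p ∈ T, classCost p.2 p.1 := by
  calc ∑ δ ∈ D, displacementCost s δ
      = ∑ p ∈ D.image (stepPair s), classCost p.2 p.1 := by
        rw [Finset.sum_image hD]; rfl
    _ ≤ _ := Finset.sum_le_sum_of_subset (Finset.image_subset_iff.2 hT)

/-- For a fixed sign of the unit part, `(b, |a|)` determines `δ`. From `2δ ≤ n < (q + 1)s`, a
nonnegative unit part gives `2b ≤ q`, while a negative one allows `2b ≤ q + 1`. The two products in
the bound are the rows `b = 0` and `a = 0`. -/
theorem sum_displacementCost_le {n s : ℕ} (hs : 0 < s) :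
    ∑ δ ∈ Finset.Icc 1 (n / 2), displacementCost s δ ≤
      s / 2 * (s / 2 + 1) + costSum (s / 2) (n / s / 2) + n / s / 2 * (n / s / 2 + 1)
        + costSum (s / 2) ((n / s + 1) / 2) := by
  set q := n / s
  have hq : n < (q + 1) * s := by
    rw [add_mul, one_mul]; exact Nat.lt_div_mul_add hs
  set h := s / 2 with hh
  set D := Finset.Icc 1 (n / 2) with hD
  have hδ : ∀ δ ∈ D, 0 < δ ∧ 2 * δ ≤ n := fun δ hδ => by
    have := Finset.mem_Icc.1 hδ
    omega
  have hrep : ∀ δ : ℕ, (δ : ℤ) = unitSteps s δ + ((longSteps s δ * s : ℕ) : ℤ) := fun δ => by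
    rw [Nat.cast_mul]; exact unitSteps_add s δ
  have habs : ∀ δ, (unitSteps s δ).natAbs ≤ h := natAbs_unitSteps_le hs
  have hT : ∀ (B : ℕ), ∑ p ∈ (Finset.range B).map ⟨_, Nat.succ_injective⟩ ×ˢ
      (Finset.range h).map ⟨_, Nat.succ_injective⟩, classCost p.2 p.1 = costSum h B := by
    intro B
    rw [Finset.sum_product, Finset.sum_map]
    simp only [Finset.sum_map]
    rfl
  have hmem : ∀ m i : ℕ, i ∈ (Finset.range m).map ⟨_, Nat.succ_injective⟩ ↔ 0 < i ∧ i ≤ m := by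
    intro m i
    simp only [Finset.mem_map, Finset.mem_range, Function.Embedding.coeFn_mk]
    constructor
    · rintro ⟨j, hj, rfl⟩; omega
    · rintro ⟨h1, h2⟩; exact ⟨i - 1, by omega, by omega⟩
  have hlt : ∀ δ ∈ D, 0 ≤ unitSteps s δ → longSteps s δ ≤ q / 2 := by
    intro δ h1 h2
    have h3 := hrep δ
    have h4 := hδ δ h1
    have h5 : (2 * longSteps s δ) * s < (q + 1) * s := by rw [mul_assoc]; omega
    have := Nat.lt_of_mul_lt_mul_right h5
    omega
  have hcost : ∀ (a : ℕ), classCost a 0 ≤ 2 * a := fun a => (classCost_le a 0).trans (by simp)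
  have hpos : ∑ δ ∈ D.filter (fun δ => 0 < unitSteps s δ), displacementCost s δ ≤
      h * (h + 1) + costSum h (q / 2) := by
    refine (sum_displacementCost_le_of_injOn ?_
      (({0} ×ˢ (Finset.range h).map ⟨_, Nat.succ_injective⟩) ∪
        ((Finset.range (q / 2)).map ⟨_, Nat.succ_injective⟩ ×ˢ
          (Finset.range h).map ⟨_, Nat.succ_injective⟩)) ?_).trans ?_
    · intro δ h1 δ' h2 heq
      have h1 := (Finset.mem_filter.1 h1).2
      have h2 := (Finset.mem_filter.1 h2).2
      obtain ⟨e1, e2⟩ := Prod.mk.inj heq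
      have r1 := hrep δ
      have r2 := hrep δ'
      rw [e1] at r1
      omega
    · intro δ h1
      obtain ⟨h1, h2⟩ := Finset.mem_filter.1 h1
      have h3 := hlt δ h1 h2.le
      have h4 := habs δ
      simp only [stepPair, Finset.mem_union, Finset.mem_product, hmem, Finset.mem_singleton]
      omega
    · have hu := Finset.sum_union_inter (f := fun p : ℕ × ℕ => classCost p.2 p.1)
        (s₁ := {0} ×ˢ (Finset.range h).map ⟨_, Nat.succ_injective⟩)
        (s₂ := (Finset.range (q / 2)).map ⟨_, Nat.succ_injective⟩ ×ˢ
          (Finset.range h).map ⟨_, Nat.succ_injective⟩)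
      rw [hT] at hu
      have h0 : ∑ p ∈ {0} ×ˢ (Finset.range h).map ⟨_, Nat.succ_injective⟩, classCost p.2 p.1
          ≤ h * (h + 1) := by
        rw [Finset.sum_product, Finset.sum_singleton, Finset.sum_map]
        clear_value h
        clear hu hT hD hδ hrep habs hmem hlt hh
        induction h with
        | zero => simp
        | succ h ih =>
          rw [Finset.sum_range_succ]
          have := hcost (h + 1)
          have e : (h + 1) * (h + 1 + 1) = h * (h + 1) + 2 * (h + 1) := by ring
          simp only [Function.Embedding.coeFn_mk, Nat.succ_eq_add_one] at ih ⊢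
          omega
      omega
  have hzero : ∑ δ ∈ D.filter (fun δ => unitSteps s δ = 0), displacementCost s δ ≤
      q / 2 * (q / 2 + 1) := by
    refine (sum_displacementCost_le_of_injOn ?_
      ((Finset.range (q / 2)).map ⟨_, Nat.succ_injective⟩ ×ˢ {0}) ?_).trans ?_
    · intro δ h1 δ' h2 heq
      have h1 := (Finset.mem_filter.1 h1).2
      have h2 := (Finset.mem_filter.1 h2).2
      obtain ⟨e1, e2⟩ := Prod.mk.inj heq
      have r1 := hrep δ
      have r2 := hrep δ'
      rw [e1] at r1
      omega
    · intro δ h1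
      obtain ⟨h1, h2⟩ := Finset.mem_filter.1 h1
      have h3 := hlt δ h1 h2.ge
      have h4 : 0 < longSteps s δ := by
        refine Nat.pos_of_ne_zero fun h0 => ?_
        have h5 := hrep δ
        have h6 := hδ δ h1
        rw [h0, Nat.zero_mul] at h5
        omega
      simp only [stepPair, Finset.mem_product, hmem, Finset.mem_singleton]
      omega
    · rw [Finset.sum_product, Finset.sum_map]
      simp only [Finset.sum_singleton, Function.Embedding.coeFn_mk]
      generalize q / 2 = B
      induction B with
      | zero => simp
      | succ B ih =>
        rw [Finset.sum_range_succ]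
        have : classCost 0 B.succ ≤ 2 * 0 + 2 * (B + 1) := classCost_le _ _
        have e : (B + 1) * (B + 1 + 1) = B * (B + 1) + 2 * (B + 1) := by ring
        omega
  have hneg : ∑ δ ∈ D.filter (fun δ => unitSteps s δ < 0), displacementCost s δ ≤
      costSum h ((q + 1) / 2) := by
    refine (sum_displacementCost_le_of_injOn ?_
      ((Finset.range ((q + 1) / 2)).map ⟨_, Nat.succ_injective⟩ ×ˢ
          (Finset.range h).map ⟨_, Nat.succ_injective⟩) ?_).trans (hT _).le
    · intro δ h1 δ' h2 heq
      have h1 := (Finset.mem_filter.1 h1).2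
      have h2 := (Finset.mem_filter.1 h2).2
      obtain ⟨e1, e2⟩ := Prod.mk.inj heq
      have r1 := hrep δ
      have r2 := hrep δ'
      rw [e1] at r1
      omega
    · intro δ h1
      obtain ⟨h1, h2⟩ := Finset.mem_filter.1 h1
      have h3 := hrep δ
      have h4 := hδ δ h1
      have h6 := habs δ
      have h5 : (2 * longSteps s δ) * s < (q + 1 + 1) * s := by
        rw [mul_assoc, add_mul (q + 1)]; omega
      have := Nat.lt_of_mul_lt_mul_right h5
      have h7 : 0 < longSteps s δ := by
        refine Nat.pos_of_ne_zero fun h0 => ?_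
        rw [h0, Nat.zero_mul] at h3
        omega
      simp only [stepPair, Finset.mem_product, hmem]
      omega
  have hsplit : ∑ δ ∈ D, displacementCost s δ =
      ∑ δ ∈ D.filter (fun δ => 0 < unitSteps s δ), displacementCost s δ +
      (∑ δ ∈ D.filter (fun δ => unitSteps s δ = 0), displacementCost s δ +
      ∑ δ ∈ D.filter (fun δ => unitSteps s δ < 0), displacementCost s δ) := by
    simp only [Finset.sum_filter, ← Finset.sum_add_distrib]
    refine Finset.sum_congr rfl fun δ _ => ?_
    rcases lt_trichotomy (unitSteps s δ) 0 with h1 | h1 | h1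
    · simp [h1, h1.ne, h1.not_gt]
    · simp [h1]
    · simp [h1, h1.ne', h1.not_gt]
  omega

end CostSums

/-! ### Square-root conditions as linear inequalities -/

section Regimes

/-- Squaring turns the condition into `x^2 - 2kx ≤ yx`. It is applied with `x = s`, `y = q`, `k =
κ(a)`. -/
theorem le_of_le_sqrt_add {x y k : ℝ} (hx : 0 < x) (h : x ≤ √(y * x + k ^ 2) + k)
    (hk : k < x) : x ≤ y + 2 * k := by
  have h1 : x - k ≤ √(y * x + k ^ 2) := by linarith
  have h2 : (x - k) ^ 2 ≤ y * x + k ^ 2 := by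
    by_contra hlt
    have := Real.sqrt_lt_sqrt_iff_of_pos (x := y * x + k ^ 2) (y := (x - k) ^ 2)
      (by have : 0 < x - k := by linarith
          positivity)
    have h3 := this.2 (not_le.1 hlt)
    rw [Real.sqrt_sq (by linarith)] at h3
    linarith
  by_contra hlt
  nlinarith

theorem le_of_sqrt_add_le {x y k : ℝ} (hx : 0 < x) (h : √(y * x + k ^ 2) + k ≤ x) :
    y + 2 * k ≤ x := by
  have h1 : √(y * x + k ^ 2) ≤ x - k := by linarith
  have h2 : y * x + k ^ 2 ≤ (x - k) ^ 2 := (Real.sqrt_le_left (by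
    exact (Real.sqrt_nonneg _).trans h1)).1 h1
  by_contra hlt
  nlinarith

end Regimes

/-! ### Polynomial comparison and assembly -/

section MainTheorem

/-- Here `s = 2h + f` and `q = 2B + e`, with `d` the slack in the regime condition. Expressed in `h`
and `d`, the difference of the two sides has only nonnegative coefficients. -/
theorem upper_bound_small {h B e f U : ℝ} {d : ℝ} (hh : 0 ≤ h) (hd : 0 ≤ d)
    (he : e = 0 ∨ e = 1) (hf : f = 0 ∨ f = 1) (hB : B = h + 2 + d - e)
    (hU : U ≤ h * (h + 1) + (h * (B * (B + 1)) + (B - 2) * (h * (h + 1)) / 2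
      + h * (h + 1) * (2 * h + 1) / 3) + B * (B + 1) + (h * ((B + e) * (B + e + 1))
      + ((B + e) - 2) * (h * (h + 1)) / 2 + h * (h + 1) * (2 * h + 1) / 3)) :
    U ≤ ((2 * h + f) + 2) / 24 * (6 * (2 * B + e) ^ 2 + 3 * (2 * B + e) * ((2 * h + f) + 4)
      + (2 * h + f) * (4 * (2 * h + f) + 10)
          + e * (2 * (2 * B + e) + 3 * (2 * h + f) + 3)) := by
  refine hU.trans ?_
  subst hB
  rw [← sub_nonneg]
  rcases he with rfl | rfl <;> rcases hf with rfl | rfl <;> ring_nf <;> positivity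

theorem upper_bound_medium {h B e f U : ℝ} (hh : 0 ≤ h)
    (he : e = 0 ∨ e = 1) (hf : f = 0 ∨ f = 1) (hB : B = h - e ∨ B = h + 1 - e) (hB0 : 0 ≤ B)
    (hU : U ≤ h * (h + 1) + (h * (B * (B + 1)) + B * (h * (h + 1))) + B * (B + 1)
      + (h * ((B + e) * (B + e + 1)) + (B + e) * (h * (h + 1)))) :
    U ≤ (2 * B + e) * ((2 * B + e) + 2) * (5 * (2 * B + e) + 2) / 24
        + (2 * h + f) * ((2 * h + f) + 2) * (2 * (2 * h + f) + 5) / 6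
        + e * ((5 * (2 * B + e) ^ 2 + 13 * (2 * B + e) + 7) / 8) := by
  refine hU.trans ?_
  rw [← sub_nonneg]
  rcases hB with hB | hB
  -- Eliminating `h` rather than `B` keeps the remaining variable nonnegative without subtracting
  -- `e`.
  · obtain rfl : h = B + e := by linarith
    rcases he with rfl | rfl <;> rcases hf with rfl | rfl <;> ring_nf <;> positivity
  · subst hB
    rcases he with rfl | rfl <;> rcases hf with rfl | rfl <;> ring_nf <;> positivity

theorem upper_bound_large {h B e f U : ℝ} {d : ℝ} (hB : 0 ≤ B) (hd : 0 ≤ d)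
    (he : e = 0 ∨ e = 1) (hf : f = 0 ∨ f = 1) (hh : h = B + e + 1 + d)
    (hU : U ≤ h * (h + 1) + (h * (B * (B + 1)) + B * (h * (h + 1))) + B * (B + 1)
      + (h * ((B + e) * (B + e + 1)) + (B + e) * (h * (h + 1)))) :
    U ≤ (2 * B + e) * ((2 * B + e) + 2) * ((2 * B + e) + 10) / 24
        + (2 * h + f) * ((2 * h + f) + 2) * ((2 * B + e) + 1) / 2
        + e * ((((2 * B + e) + 5) ^ 2 + 4 * ((2 * h + f) + 1) ^ 2) / 8) := by
  refine hU.trans ?_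
  subst hh
  rw [← sub_nonneg]
  rcases he with rfl | rfl <;> rcases hf with rfl | rfl <;> ring_nf <;> positivity

theorem parityEps_eq (x : ℕ) :
    (parityEps x = 0 ∨ parityEps x = 1) ∧ (x : ℝ) = 2 * ((x / 2 : ℕ) : ℝ) + parityEps x ∧
      (((x + 1) / 2 : ℕ) : ℝ) = ((x / 2 : ℕ) : ℝ) + parityEps x := by
  unfold parityEps
  have h1 : x = 2 * (x / 2) + x % 2 := by omega
  have h2 : (x + 1) / 2 = x / 2 + x % 2 := by omega
  refine ⟨?_, by exact_mod_cast h1, by exact_mod_cast h2⟩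
  rcases Nat.mod_two_eq_zero_or_one x with h | h <;> simp [h]

theorem mainTheorem2 (n s q r : ℕ) (hn : 5 ≤ n) (hs : 1 < s) (hsn : 2 * s < n)
    (hq : q = n / s) (hr : n = q * s + r) (W : ℝ)
    (hW : W = (directedOpticalIndex (circulantOneS n s) : ℝ) ∨
      W = (undirectedOpticalIndex (circulantOneS n s) : ℝ) / 2) :
    ((2 ≤ s ∧ (s : ℝ) ≤ √((n : ℝ) - r + kappa s q (-2) ^ 2) + kappa s q (-2)) →
      ((n : ℝ) ^ 2 - parityEps n) / (8 * ((s : ℝ) + 1)) ≤ W ∧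
      W ≤ ((s : ℝ) + 2) / 24 *
        (6 * (q : ℝ) ^ 2 + 3 * q * ((s : ℝ) + 4) + s * (4 * (s : ℝ) + 10)
          + parityEps q * (2 * (q : ℝ) + 3 * s + 3))) ∧
    ((√((n : ℝ) - r + kappa s q (-1) ^ 2) + kappa s q (-1) ≤ s ∧
        (s : ℝ) ≤ √((n : ℝ) - r + kappa s q 0 ^ 2) + kappa s q 0) →
      ((n : ℝ) ^ 2 - parityEps n) / (8 * ((s : ℝ) + 1)) ≤ W ∧
      W ≤ (q : ℝ) * ((q : ℝ) + 2) * (5 * (q : ℝ) + 2) / 24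
        + (s : ℝ) * ((s : ℝ) + 2) * (2 * (s : ℝ) + 5) / 6
        + parityEps q * ((5 * (q : ℝ) ^ 2 + 13 * q + 7) / 8)) ∧
    ((√((n : ℝ) - r + kappa s q 1 ^ 2) + kappa s q 1 ≤ s ∧ (s : ℝ) < (n : ℝ) / 2) →
      max (((n : ℝ) ^ 2 - parityEps n) / (8 * ((s : ℝ) + 1)))
          (((n : ℝ) - 1) * (√(2 * (n : ℝ)) - 7) ^ 3 / (24 * (n : ℝ))) ≤ W ∧
      W ≤ (q : ℝ) * ((q : ℝ) + 2) * ((q : ℝ) + 10) / 24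
        + (s : ℝ) * ((s : ℝ) + 2) * ((q : ℝ) + 1) / 2
        + parityEps q * ((((q : ℝ) + 5) ^ 2 + 4 * ((s : ℝ) + 1) ^ 2) / 8)) := by

  have : NeZero n := ⟨by omega⟩
  have hnr : (n : ℝ) - r = q * s := by
    rw [hr]; push_cast; ring
  rw [hnr]
  obtain ⟨K, R, hR, hKW⟩ : ∃ (K : ℕ) (R : Routing (circulantOneS n s)),
      (∀ e, edgeLoad R e ≤ K) ∧ (K : ℝ) / 2 = W := by
    -- Without a routing the infimum over an empty set would be `0`, and the lower bounds would not
    -- follow.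
    have hne : Nonempty (Routing (circulantOneS n s)) :=
      ⟨(exists_routing (by omega) hsn).choose⟩
    rcases hW with h | h
    · obtain ⟨R, hR⟩ := exists_edgeLoad_le_two_mul_directedOpticalIndex hne
      exact ⟨_, R, hR, by rw [h]; push_cast; ring⟩
    · obtain ⟨R, hR⟩ := exists_edgeLoad_le_undirectedOpticalIndex hne
      exact ⟨_, R, hR, h.symm⟩
  have hlow := bisection_bound_of_edgeLoad_le (by omega : s ≤ n) hR
  have hlow' := distance_bound_of_edgeLoad_le hR
  rw [hKW] at hlow hlow'
  have hup : W ≤ ((s / 2 * (s / 2 + 1) + costSum (s / 2) (q / 2) + q / 2 * (q / 2 + 1)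
        + costSum (s / 2) ((q + 1) / 2) : ℕ) : ℝ) := by
    have h1 := opticalIndex_le_sum_displacementCost hs hsn
    have h2 := sum_displacementCost_le (n := n) (s := s) (by omega)
    rw [← hq] at h2
    refine le_trans ?_ (Nat.cast_le.2 h2)
    rcases hW with h | h
    · rw [h]; exact_mod_cast h1.1
    · have : (undirectedOpticalIndex (circulantOneS n s) : ℝ)
          ≤ 2 * ((∑ δ ∈ Finset.Icc 1 (n / 2), displacementCost s δ : ℕ) : ℝ) := by
        exact_mod_cast h1.2
      rw [h]; linarith
  push_cast at hup
  have hs0 : (2 : ℝ) ≤ s := by exact_mod_cast hs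
  obtain ⟨hse, hs2, -⟩ := parityEps_eq s
  obtain ⟨hqe, hq2, hq3⟩ := parityEps_eq q
  have hκ : ∀ a, 2 * kappa s q a = 2 * a + (parityEps s + parityEps q) := fun a => by
    unfold kappa; ring
  have hκ0 : ∀ a : ℝ, a ≤ 0 → kappa s q a < s := by
    intro a ha
    have := hκ a
    rcases hse with h | h <;> rcases hqe with h' | h' <;> rw [h, h'] at this <;> linarith
  have hh0 : (0 : ℝ) ≤ (s / 2 : ℕ) := Nat.cast_nonneg _
  have hB0 : (0 : ℝ) ≤ (q / 2 : ℕ) := Nat.cast_nonneg _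
  have hshort : W ≤ _ := hup.trans (add_le_add_three (add_le_add_right (costSum_le _ _) _) le_rfl
    (costSum_le _ _))
  have hlong : W ≤ _ := hup.trans (add_le_add_three
    (add_le_add_right (costSum_le_of_long _ _) _) le_rfl (costSum_le_of_long _ _))
  rw [hq3] at hshort hlong
  refine ⟨fun ⟨_, h⟩ => ⟨hlow, ?_⟩, fun ⟨h, h'⟩ => ⟨hlow, ?_⟩,
    fun ⟨h, _⟩ => ⟨max_le hlow hlow', ?_⟩⟩
  · have h1 := le_of_le_sqrt_add (by linarith) h (hκ0 _ (by norm_num))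
    rw [hκ, hs2, hq2] at h1
    rw [hs2, hq2]
    exact upper_bound_small hh0
      (d := ((q / 2 : ℕ) : ℝ) + parityEps q - (s / 2 : ℕ) - 2) (by linarith) hqe hse (by ring) hlong
  · have h1 := le_of_sqrt_add_le (by linarith) h
    have h2 := le_of_le_sqrt_add (by linarith) h' (hκ0 _ le_rfl)
    rw [hκ, hs2, hq2] at h1 h2
    -- The middle regime confines `⌈q/2⌉` to the two integers `⌊s/2⌋` and `⌊s/2⌋ + 1`.
    have hB : ((q / 2 : ℕ) : ℝ) = (s / 2 : ℕ) - parityEps q ∨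
        ((q / 2 : ℕ) : ℝ) = (s / 2 : ℕ) + 1 - parityEps q := by
      have h3 : (((q + 1) / 2 : ℕ) : ℝ) ≤ ((s / 2 + 1 : ℕ) : ℝ) := by
        rw [hq3]; push_cast; linarith
      have h4 : ((s / 2 : ℕ) : ℝ) ≤ ((q + 1) / 2 : ℕ) := by
        rw [hq3]; linarith
      have h5 : (q + 1) / 2 = s / 2 ∨ (q + 1) / 2 = s / 2 + 1 := by
        have := Nat.cast_le.1 h3
        have := Nat.cast_le.1 h4
        omega
      rcases h5 with h5 | h5 <;> rw [h5] at hq3 <;> push_cast at hq3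
      · left; linarith
      · right; linarith
    rw [hs2, hq2]
    exact upper_bound_medium hh0 hqe hse hB hB0 hshort
  · have h1 := le_of_sqrt_add_le (by linarith) h
    rw [hκ, hs2, hq2] at h1
    rw [hs2, hq2]
    exact upper_bound_large hB0
      (d := ((s / 2 : ℕ) : ℝ) - ((q / 2 : ℕ) + parityEps q + 1)) (by linarith) hqe hse (by ring)
      hshort

end MainTheorem
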